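/- Let $d \geq 2$ be an integer and $s \in (\frac12, \frac d2)$. For a tempered distribution $f$ on $\mathbb{R}^d$ let $\widehat f$ be its Fourier transform, normalised by $\widehat f(\xi) = \int_{\mathbb{R}^d} f(x) e^{-i x\cdot \xi}\,dx$. Let $\dot H^s(\mathbb{R}^d)$ be the space of tempered distributions $f$ whose Fourier transform is a locally integrable function with $$\|f\|_{\dot H^s(\mathbb{R}^d)}^2 = \frac{1}{(2\pi)^d}\int_{\mathbb{R}^d} |\xi|^{2s} |\widehat f(\xi)|^2 \, d\xi < \infty .$$ Let $d\sigma$ be the induced Lebesgue measure on the unit sphere $\mathbb{S}^{d-1}$, and let $\mathcal{R}$ be the restriction operator to $\mathbb{S}^{d-1}$, that is, the extension by continuity to $\dot H^s(\mathbb{R}^d) \to L^2(\mathbb{S}^{d-1}, d\sigma)$ of the pointwise restriction of Schwartz functions. This extension is well defined on all of $\dot H^s(\mathbb{R}^d)$, and $$\|\mathcal{R} f\|_{L^2(\mathbb{S}^{d-1},d\sigma)}^2 \leq 2^{1-2s}\, \frac{\Gamma(2s-1)\,\Gamma(\frac d2 - s)}{\Gamma(s)^2\, \Gamma(\frac d2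 - 1 + s)}\, \|f\|_{\dot H^s(\mathbb{R}^d)}^2 \qquad (f \in \dot H^s(\mathbb{R}^d)). \tag{1}$$ Call $f$ an extremiser for (1) if $f \in \dot H^s(\mathbb{R}^d)$, $f \neq 0$ and equality holds in (1). Then $f$ is an extremiser for (1) if and only if $$f \in \operatorname{span}\left( \frac{1}{|\cdot|^{d-2s}} * d\sigma \right) \setminus \{0\},$$ or equivalently, if and only if $$\widehat f \in \operatorname{span}\left( \frac{J_{\frac d2 - 1}(|\cdot|)}{|\cdot|^{\frac d2 + 2s - 1}} \right) \setminus \{0\},$$ where spans are over $\mathbb{C}$ and $J_{\frac d2-1}$ is the Bessel function of the first kind of order $\frac d2 - 1$. -/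

import Mathlib

open MeasureTheory Filter Topology
open scoped SchwartzMap ENNReal FourierTransform

noncomputable section

namespace SphereTrace

/-- `ℝ^d` with its Euclidean norm. -/
abbrev Euc (d : ℕ) : Type := EuclideanSpace ℝ (Fin d)

/-- The unit sphere of `ℝ^d`. -/
abbrev Sph (d : ℕ) : Type := Metric.sphere (0 : Euc d) 1

/-- The induced Lebesgue (surface) measure on the unit sphere, of total mass `d * |B(0,1)|`. -/
abbrev surf (d : ℕ) : Measure (Sph d) := (volume : Measure (Euc d)).toSphere

/-- The dilation `ξ ↦ (2π)⁻¹ ξ`. -/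
def dil (d : ℕ) : Euc d ≃L[ℝ] Euc d :=
  ContinuousLinearEquiv.smulLeft (Units.mk0 ((2 * Real.pi)⁻¹ : ℝ) (by positivity))

/-- The Fourier transform `φ ↦ ∫ φ(x) exp(-i x·ξ) dx` on Schwartz functions, obtained from
Mathlib's `𝓕 φ (ξ) = ∫ φ(x) exp(-2π i x·ξ) dx` by rescaling `ξ`. -/
def schwartzHat (d : ℕ) : 𝓢(Euc d, ℂ) →L[ℂ] 𝓢(Euc d, ℂ) :=
  (SchwartzMap.compCLMOfContinuousLinearEquiv ℂ (dil d)).comp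
    (FourierTransform.fourierCLM ℂ 𝓢(Euc d, ℂ))

theorem schwartzHat_apply (d : ℕ) (φ : 𝓢(Euc d, ℂ)) (ξ : Euc d) :
    schwartzHat d φ ξ = ∫ x, Complex.exp (-Complex.I * (inner ℝ x ξ : ℝ)) * φ x := by
  have h : schwartzHat d φ ξ = 𝓕 (φ : Euc d → ℂ) (((2 * Real.pi)⁻¹ : ℝ) • ξ) := rfl
  rw [h, Real.fourier_eq']
  congr 1
  ext x
  rw [smul_eq_mul, real_inner_smul_right]
  congr 2
  push_cast
  have : (Real.pi : ℂ) ≠ 0 := by exact_mod_cast Real.pi_ne_zero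
  field_simp

/-- The Fourier transform of a tempered distribution, `⟨f̂, φ⟩ = ⟨f, φ̂⟩`. -/
def hat {d : ℕ} (f : 𝓢'(Euc d, ℂ)) : 𝓢'(Euc d, ℂ) :=
  PointwiseConvergenceCLM.precomp ℂ (schwartzHat d) f

theorem hat_apply {d : ℕ} (f : 𝓢'(Euc d, ℂ)) (φ : 𝓢(Euc d, ℂ)) :
    hat f φ = f (schwartzHat d φ) := rfl

/-- The tempered distribution `T` is the function `u`: `⟨T, φ⟩ = ∫ u φ`, with an absolutely
convergent integral, for all Schwartz functions `φ`. -/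
def Represents {d : ℕ} (u : Euc d → ℂ) (T : 𝓢'(Euc d, ℂ)) : Prop :=
  ∀ φ : 𝓢(Euc d, ℂ), Integrable (fun x => u x * φ x) ∧ T φ = ∫ x, u x * φ x

/-- The norm `‖f‖ = ‖(-Δ)^{s/2} f‖_{L²} = ((2π)^{-d} ∫ |ξ|^{2s} |f̂(ξ)|² dξ)^{1/2}` of the homogeneous
Sobolev space of order `s`, with the value `∞` if `f̂` is not a function or the integral diverges.
The infimum runs over the representatives of `f̂`, which agree almost everywhere. -/
def sobolevENorm {d : ℕ} (s : ℝ) (f : 𝓢'(Euc d, ℂ)) : ℝ≥0∞ :=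
  ⨅ (h : Euc d → ℂ) (_ : Represents h (hat f)),
    (ENNReal.ofReal (((2 * Real.pi) ^ d)⁻¹) *
      ∫⁻ ξ, ENNReal.ofReal (‖ξ‖ ^ (2 * s)) * ‖h ξ‖ₑ ^ 2) ^ (1 / 2 : ℝ)

/-- Membership in the homogeneous Sobolev space of order `s` (here `s < d / 2`). -/
def MemSobolevHom {d : ℕ} (s : ℝ) (f : 𝓢'(Euc d, ℂ)) : Prop :=
  sobolevENorm s f < ∞

/-- The norm of the homogeneous Sobolev space as a real number. -/
def sobolevNorm {d : ℕ} (s : ℝ) (f : 𝓢'(Euc d, ℂ)) : ℝ := (sobolevENorm s f).toReal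

/-- `G` is the restriction `R f` of `f` to the unit sphere: `R` is the continuous extension,
from the homogeneous Sobolev space of order `s` to `L²` of the sphere, of the pointwise restriction
of Schwartz functions. -/
def IsTrace {d : ℕ} (s : ℝ) (f : 𝓢'(Euc d, ℂ)) (G : Lp ℂ 2 (surf d)) : Prop :=
  ∃ φ : ℕ → 𝓢(Euc d, ℂ),
    Tendsto (fun n => sobolevENorm s ((φ n : 𝓢'(Euc d, ℂ)) - f)) atTop (𝓝 0) ∧
    Tendsto (fun n => eLpNorm (fun ω : Sph d => φ n (ω : Euc d) - G ω) 2 (surf d)) atTop (𝓝 0)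

/-- The constant `2^{1-2s} Γ(2s-1) Γ(d/2-s) / (Γ(s)² Γ(d/2-1+s))`. -/
def traceConst (d : ℕ) (s : ℝ) : ℝ :=
  2 ^ (1 - 2 * s) * (Real.Gamma (2 * s - 1) * Real.Gamma (d / 2 - s) /
    (Real.Gamma s ^ 2 * Real.Gamma (d / 2 - 1 + s)))

/-- `f` is an extremiser of the sharp trace inequality: a nonzero element of the homogeneous
Sobolev space of order `s` for which equality holds. -/
def IsExtremiser {d : ℕ} (s : ℝ) (f : 𝓢'(Euc d, ℂ)) : Prop :=
  MemSobolevHom s f ∧ f ≠ 0 ∧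
    ∃ G : Lp ℂ 2 (surf d), IsTrace s f G ∧ ‖G‖ ^ 2 = traceConst d s * sobolevNorm s f ^ 2

/-- The convolution `|·|^{2s-d} * dσ`. -/
def rieszConvSurf (d : ℕ) (s : ℝ) (x : Euc d) : ℂ :=
  ((∫ ω : Sph d, 1 / ‖x - (ω : Euc d)‖ ^ ((d : ℝ) - 2 * s) ∂(surf d) : ℝ) : ℂ)

/-- The Bessel function of the first kind `J_ν(r)`, for `r ≥ 0`. -/
def besselJ (ν r : ℝ) : ℝ :=
  ∑' m : ℕ, (-1) ^ m / (m.factorial * Real.Gamma (m + ν + 1)) * (r / 2) ^ (2 * (m : ℝ) + ν)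

/-- The function `J_{d/2-1}(|ξ|) / |ξ|^{d/2+2s-1}`. -/
def besselProfile (d : ℕ) (s : ℝ) (ξ : Euc d) : ℂ :=
  ((besselJ ((d : ℝ) / 2 - 1) ‖ξ‖ / ‖ξ‖ ^ ((d : ℝ) / 2 + 2 * s - 1) : ℝ) : ℂ)

end SphereTrace

end

namespace SphereTrace

/-! On the Fourier side the space is `L²(μ)` with `dμ = (2π)^{-d} |ξ|^{2s} dξ`, and restriction to
the sphere is the adjoint of `E g = |ξ|^{-2s} (g dσ)^` (`adjoint_extCLM_schwartzHat`,
`isTrace_iff`). So the sharp trace inequality is the sharp bound for `E`, read by duality.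

Writing `|ξ|^{-2s}` as a superposition of Gaussians gives `‖E g‖² = const · ∬ |ω-η|^{2s-d} g(ω) conj
g(η) dσ dσ` (`lintegral_sphFT_sq`). This kernel is positive off the diagonal and its integral in `η`
is a constant `K` independent of `ω` (`lintegral_riesz_sphere`). Expanding `|g(ω) - g(η)|²` shows
that the form equals `K ‖g‖² - ½ ∬ |ω-η|^{2s-d} |g(ω) - g(η)|²` (`integrable_and_rieszForm_re`).
Hence `‖E g‖² ≤ C ‖g‖²`, with equality exactly for constant `g`; `traceConst_eq` identifies `C`.

In Hilbert space, equality `‖E* h‖² = C ‖h‖²` forces `E E* h = C h` and makes `E* h` an extremiser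
of `E`, thus constant. So `h` is a multiple of `E 1 = |ξ|^{-2s} (dσ)^`, which is the Bessel profile
(`extFun_one_eq`); the converse is the same argument with the operators exchanged. The Fourier
transform of the Riesz kernel turns this into the convolution form (`represents_rieszConvSurf_iff`).
-/

variable {d : ℕ}

/-! ### Gaussian moments of a linear form. -/

theorem integral_exp_inner_mul_gaussian (ξ : Euc d) (t : ℝ) :
    ∫ x : Euc d, Real.exp (-‖x‖ ^ 2) * Real.exp (t * inner ℝ ξ x) =
      Real.pi ^ ((d : ℝ) / 2) * Real.exp (t ^ 2 * ‖ξ‖ ^ 2 / 4) := by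
  have h := GaussianFourier.integral_cexp_neg_mul_sq_norm_add (V := Euc d) (b := 1) (by simp) t ξ
  rw [← Complex.ofReal_inj, ← integral_complex_ofReal]
  convert h using 1
  · congr 1
    ext x
    push_cast
    rw [← Complex.exp_add]
    ring_nf
  · rw [finrank_euclideanSpace_fin]
    push_cast
    rw [Complex.ofReal_cpow Real.pi_pos.le]
    push_cast
    simp

theorem integrable_exp_inner_mul_gaussian (ξ : Euc d) (t : ℝ) :
    Integrable fun x : Euc d => Real.exp (-‖x‖ ^ 2) * Real.exp (t * inner ℝ ξ x) := by
  by_contra h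
  have := integral_exp_inner_mul_gaussian ξ t
  -- A non-integrable function has integral `0` by default, so a positive value proves
  -- integrability. The same device recurs below.
  rw [integral_undef h] at this
  have hp : 0 < Real.pi ^ ((d : ℝ) / 2) * Real.exp (t ^ 2 * ‖ξ‖ ^ 2 / 4) := by positivity
  linarith

/-- The measure with density `exp (-‖x‖ ^ 2)`. -/
noncomputable def gaussianWeight (d : ℕ) : Measure (Euc d) :=
  volume.withDensity fun x => ENNReal.ofReal (Real.exp (-‖x‖ ^ 2))

theorem integral_gaussianWeight (f : Euc d → ℝ) :
    ∫ x, f x ∂(gaussianWeight d) = ∫ x, Real.exp (-‖x‖ ^ 2) * f x := by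
  rw [gaussianWeight, integral_withDensity_eq_integral_toReal_smul (by fun_prop) (by simp)]
  refine integral_congr_ae (.of_forall fun x => ?_)
  simp [ENNReal.toReal_ofReal (Real.exp_pos _).le]

theorem integrable_gaussianWeight_iff {f : Euc d → ℝ} :
    Integrable f (gaussianWeight d) ↔ Integrable fun x => Real.exp (-‖x‖ ^ 2) * f x := by
  rw [gaussianWeight, integrable_withDensity_iff_integrable_smul' (by fun_prop) (by simp)]
  refine integrable_congr (.of_forall fun x => ?_)
  simp [ENNReal.toReal_ofReal (Real.exp_pos _).le]

theorem mgf_inner_gaussianWeight (ξ : Euc d) (t : ℝ) :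
    ProbabilityTheory.mgf (fun x => inner ℝ ξ x) (gaussianWeight d) t =
      Real.pi ^ ((d : ℝ) / 2) * Real.exp (t ^ 2 * ‖ξ‖ ^ 2 / 4) := by
  rw [ProbabilityTheory.mgf, integral_gaussianWeight, integral_exp_inner_mul_gaussian]

/-- The Taylor coefficients of `t ↦ A * exp (a * t ^ 2)`. -/
noncomputable def gaussCoeff (A a : ℝ) (n : ℕ) : ℝ :=
  if Even n then A * (a ^ (n / 2) / (n / 2).factorial) else 0

theorem hasSum_gaussCoeff (A a t : ℝ) :
    HasSum (fun n => t ^ n • gaussCoeff A a n) (A * Real.exp (a * t ^ 2)) := by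
  have h : HasSum (fun m : ℕ => A * ((a * t ^ 2) ^ m / m.factorial)) (A * Real.exp (a * t ^ 2)) := by
    rw [Real.exp_eq_exp_ℝ]
    exact (NormedSpace.expSeries_div_hasSum_exp (a * t ^ 2)).mul_left A
  have hinj : Function.Injective fun m : ℕ => 2 * m := fun a b h => by
    simpa using h
  rw [← hinj.hasSum_iff]
  · convert h using 2 with m
    simp [gaussCoeff]
    ring_nf
  · intro n hn
    have : ¬ Even n := fun ⟨k, hk⟩ => hn ⟨k, by simp; omega⟩
    simp [gaussCoeff, this]

/-- The moments are `n!` times the Taylor coefficients at `0` of the moment generating function,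
which is an explicit Gaussian; uniqueness of power series identifies the two. -/
theorem integral_inner_pow_mul_gaussian (ξ : Euc d) (n : ℕ) :
    ∫ x : Euc d, Real.exp (-‖x‖ ^ 2) * inner ℝ ξ x ^ n =
      n.factorial * gaussCoeff (Real.pi ^ ((d : ℝ) / 2)) (‖ξ‖ ^ 2 / 4) n := by
  have huniv : ProbabilityTheory.integrableExpSet (fun x => inner ℝ ξ x) (gaussianWeight d) =
      Set.univ := Set.eq_univ_of_forall fun t =>
    integrable_gaussianWeight_iff.2 (integrable_exp_inner_mul_gaussian ξ t)
  have h1 := ProbabilityTheory.hasFPowerSeriesAt_mgf (X := fun x => inner ℝ ξ x)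
    (μ := gaussianWeight d) (v := 0) (by simp [huniv])
  have h2 : HasFPowerSeriesAt (ProbabilityTheory.mgf (fun x => inner ℝ ξ x) (gaussianWeight d))
      (FormalMultilinearSeries.ofScalars ℝ
        (gaussCoeff (Real.pi ^ ((d : ℝ) / 2)) (‖ξ‖ ^ 2 / 4))) 0 := by
    rw [hasFPowerSeriesAt_iff]
    refine .of_forall fun t => ?_
    rw [mgf_inner_gaussianWeight, zero_add, mul_div_assoc, mul_comm (t ^ 2)]
    simp only [FormalMultilinearSeries.coeff_ofScalars]
    exact hasSum_gaussCoeff (Real.pi ^ ((d : ℝ) / 2)) (‖ξ‖ ^ 2 / 4) t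
  have h := congrFun (FormalMultilinearSeries.ofScalars_series_injective ℝ ℝ
    (h1.eq_formalMultilinearSeries h2)) n
  simp only [zero_mul, Real.exp_zero, mul_one, integral_gaussianWeight] at h
  rw [← h]
  field_simp

/-! ### Polar coordinates; moments and exponential integrals on the sphere. -/

/-- Polar coordinates for a product of an angular and a radial factor. Integrability is not needed:
the change of variables and the product formula respect the default value `0`. -/
theorem integral_eq_sphere_mul_radial [NeZero d] {f : Euc d → ℝ} {a : Sph d → ℝ} {b : ℝ → ℝ}
    (h : ∀ (ω : Sph d) (r : ℝ), 0 < r → f (r • (ω : Euc d)) = a ω * b r) :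
    ∫ x, f x = (∫ ω, a ω ∂(surf d)) * ∫ r in Set.Ioi (0 : ℝ), r ^ (d - 1) * b r := by
  have h1 : ∫ x, f x = ∫ x : ({(0)}ᶜ : Set (Euc d)), f x.1 ∂(volume.comap Subtype.val) := by
    rw [integral_subtype_comap (measurableSet_singleton _).compl f, restrict_compl_singleton]
  have h2 := (volume : Measure (Euc d)).measurePreserving_homeomorphUnitSphereProd.integral_comp
        (Homeomorph.measurableEmbedding _) (fun p => a p.1 * b p.2)
  rw [h1, ← integral_subtype_comap (measurableSet_Ioi) fun r : ℝ => r ^ (d - 1) * b r]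
  rw [integral_prod_mul a (fun r : Set.Ioi (0 : ℝ) => b r), finrank_euclideanSpace_fin] at h2
  convert h2 using 1
  · refine integral_congr_ae (.of_forall fun x => ?_)
    have hx : 0 < ‖(x : Euc d)‖ := norm_pos_iff.2 x.2
    have := h (homeomorphUnitSphereProd (Euc d) x).1 ‖(x : Euc d)‖ hx
    simp only [homeomorphUnitSphereProd_apply_fst_coe, smul_smul, mul_inv_cancel₀ hx.ne',
      one_smul] at this
    simpa using this
  · congr 1
    rw [Measure.volumeIoiPow, integral_withDensity_eq_integral_toReal_smul (by fun_prop) (by simp)]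
    refine integral_congr_ae (.of_forall fun x => ?_)
    have : (0 : ℝ) ≤ x ^ (d - 1) := pow_nonneg x.2.out.le _
    simp [ENNReal.toReal_ofReal this]

/-- Moments of a linear form on the sphere. -/
theorem integral_sphere_inner_pow [NeZero d] (ξ : Euc d) (n : ℕ) :
    (∫ ω : Sph d, inner ℝ ξ (ω : Euc d) ^ n ∂(surf d)) =
      2 * n.factorial * gaussCoeff (Real.pi ^ ((d : ℝ) / 2)) (‖ξ‖ ^ 2 / 4) n /
        Real.Gamma ((n + d) / 2) := by
  have hd : 1 ≤ d := NeZero.one_le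
  have hpos : (0 : ℝ) < (n + d) / 2 := by
    have : (1 : ℝ) ≤ d := by exact_mod_cast hd
    positivity
  have h := integral_eq_sphere_mul_radial (d := d)
    (f := fun x => Real.exp (-‖x‖ ^ 2) * inner ℝ ξ x ^ n)
    (a := fun ω => inner ℝ ξ (ω : Euc d) ^ n) (b := fun r => Real.exp (-r ^ 2) * r ^ n) (by
      intro ω r hr
      simp only [norm_smul, norm_eq_of_mem_sphere, real_inner_smul_right, Real.norm_eq_abs,
        abs_of_pos hr]
      ring_nf)
  have h3 : ∫ r in Set.Ioi (0 : ℝ), r ^ (d - 1) * (Real.exp (-r ^ 2) * r ^ n) =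
      (1 / 2) * Real.Gamma ((n + d) / 2) := by
    have := integral_rpow_mul_exp_neg_rpow (p := 2) (q := n + d - 1) (by norm_num) (by
      linarith)
    rw [show (n : ℝ) + d - 1 + 1 = n + d by ring] at this
    rw [← this]
    refine setIntegral_congr_fun measurableSet_Ioi fun r hr => ?_
    have : (r : ℝ) ^ ((n : ℝ) + d - 1) = r ^ (d - 1) * r ^ n := by
      rw [← pow_add, ← Real.rpow_natCast]
      congr 1
      push_cast [Nat.cast_sub hd]
      ring
    simp only [this, Real.rpow_two]
    ring
  rw [integral_inner_pow_mul_gaussian, h3] at h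
  have hG := Real.Gamma_pos_of_pos hpos
  field_simp
  linarith

/-- The `m`-th term of the power series of `∫ exp (z ⟨ξ, ω⟩) dσ(ω)`, with `u = z |ξ| / 2`. -/
noncomputable def sphereTerm {𝕜 : Type*} [RCLike 𝕜] (d : ℕ) (u : 𝕜) (m : ℕ) : 𝕜 :=
  ((2 * Real.pi ^ ((d : ℝ) / 2) / (m.factorial * Real.Gamma (m + d / 2)) : ℝ) : 𝕜) * u ^ (2 * m)

/-- The exponential series is integrated term by term and the odd moments vanish. Real `z` serves
the computation of the Riesz kernel's integral, `z = -i` the Fourier transform of `dσ`. -/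
theorem hasSum_sphere_exp [NeZero d] {𝕜 : Type*} [RCLike 𝕜] (ξ : Euc d) (z : 𝕜) :
    HasSum (sphereTerm d (z * (‖ξ‖ / 2 : ℝ)))
      (∫ ω : Sph d, NormedSpace.exp (z * (inner ℝ ξ (ω : Euc d) : ℝ)) ∂(surf d)) := by
  have h1 : HasSum (fun n : ℕ => ∫ ω : Sph d,
      (z * (inner ℝ ξ (ω : Euc d) : ℝ)) ^ n / n.factorial ∂(surf d))
      (∫ ω : Sph d, NormedSpace.exp (z * (inner ℝ ξ (ω : Euc d) : ℝ)) ∂(surf d)) := by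
    refine hasSum_integral_of_dominated_convergence
      (fun n _ => (‖z‖ * ‖ξ‖) ^ n / n.factorial) (fun n => ?_) (fun n => ?_) ?_ ?_ ?_
    · exact (by fun_prop : Continuous fun ω : Sph d =>
        (z * (inner ℝ ξ (ω : Euc d) : ℝ)) ^ n / (n.factorial : 𝕜)).aestronglyMeasurable
    · refine .of_forall fun ω => ?_
      rw [norm_div, norm_pow, norm_mul, RCLike.norm_natCast, RCLike.norm_ofReal]
      gcongr
      simpa using abs_real_inner_le_norm ξ (ω : Euc d)
    · exact .of_forall fun ω => Real.summable_pow_div_factorial _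
    · exact integrable_const _
    · exact .of_forall fun ω => NormedSpace.expSeries_div_hasSum_exp _
  have h2 : ∀ n : ℕ, ∫ ω : Sph d, (z * (inner ℝ ξ (ω : Euc d) : ℝ)) ^ n / n.factorial ∂(surf d) =
      z ^ n * ((2 * gaussCoeff (Real.pi ^ ((d : ℝ) / 2)) (‖ξ‖ ^ 2 / 4) n /
        Real.Gamma ((n + d) / 2) : ℝ) : 𝕜) := by
    intro n
    have hf : (n.factorial : 𝕜) ≠ 0 := by exact_mod_cast n.factorial_ne_zero
    have hf' : (n.factorial : ℝ) ≠ 0 := by exact_mod_cast n.factorial_ne_zero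
    have : ∀ ω : Sph d, (z * (inner ℝ ξ (ω : Euc d) : ℝ)) ^ n / n.factorial =
        (z ^ n / n.factorial) * ((inner ℝ ξ (ω : Euc d) ^ n : ℝ) : 𝕜) := fun ω => by
      push_cast; ring
    simp_rw [this]
    rw [integral_const_mul, integral_ofReal, integral_sphere_inner_pow]
    push_cast
    field_simp
  simp_rw [h2] at h1
  have hinj : Function.Injective fun m : ℕ => 2 * m := fun a b h => by
    simpa using h
  rw [← hinj.hasSum_iff] at h1
  · refine h1.congr_fun fun m => ?_
    simp only [sphereTerm, gaussCoeff, Function.comp, even_two, Even.mul_right, if_true]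
    have : ((2 * m : ℕ) + (d : ℝ)) / 2 = m + d / 2 := by push_cast; ring
    rw [this, Nat.mul_div_cancel_left _ two_pos, mul_pow z, pow_mul ((‖ξ‖ / 2 : ℝ) : 𝕜)]
    push_cast
    rw [div_pow, show (2 : 𝕜) ^ 2 = 4 by norm_num]
    ring
  · intro n hn
    have : ¬ Even n := fun ⟨k, hk⟩ => hn ⟨k, by simp; omega⟩
    simp [gaussCoeff, this]

/-! ### The Fourier transform of the surface measure as a Bessel function. -/

/-- The Fourier transform of the surface measure. -/
noncomputable def surfHat (d : ℕ) (ξ : Euc d) : ℂ :=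
  ∫ ω : Sph d, Complex.exp (-Complex.I * (inner ℝ (ω : Euc d) ξ : ℝ)) ∂(surf d)

theorem surfHat_eq_besselJ [NeZero d] {ξ : Euc d} (hξ : ξ ≠ 0) :
    surfHat d ξ = (((2 * Real.pi) ^ ((d : ℝ) / 2) * ‖ξ‖ ^ (1 - (d : ℝ) / 2) *
      besselJ ((d : ℝ) / 2 - 1) ‖ξ‖ : ℝ) : ℂ) := by
  have hr : 0 < ‖ξ‖ := norm_pos_iff.2 hξ
  have h := (hasSum_sphere_exp ξ (-Complex.I)).tsum_eq
  have h0 : surfHat d ξ = ∫ ω : Sph d,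
      NormedSpace.exp (-Complex.I * ((inner ℝ ξ (ω : Euc d) : ℝ) : ℂ)) ∂(surf d) := by
    simp only [surfHat, ← Complex.exp_eq_exp_ℂ, real_inner_comm]
  rw [h0]
  refine h.symm.trans ?_
  rw [besselJ, ← tsum_mul_left, Complex.ofReal_tsum]
  congr 1
  ext m
  have e1 : (-Complex.I * ((‖ξ‖ / 2 : ℝ) : ℂ)) ^ (2 * m) =
      (((-1) ^ m * (‖ξ‖ / 2) ^ (2 * m) : ℝ) : ℂ) := by
    rw [mul_pow, pow_mul (-Complex.I)]
    simp
  have e2 : (‖ξ‖ / 2) ^ (2 * (m : ℝ) + ((d : ℝ) / 2 - 1)) =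
      (‖ξ‖ / 2) ^ (2 * m) * (‖ξ‖ ^ ((d : ℝ) / 2 - 1) / (2 ^ ((d : ℝ) / 2) / 2)) := by
    rw [Real.rpow_add (by positivity), Real.div_rpow hr.le (by norm_num) ((d : ℝ) / 2 - 1),
      Real.rpow_sub_one (by norm_num : (2 : ℝ) ≠ 0)]
    congr 1
    rw [← Real.rpow_natCast]
    push_cast
    rfl
  -- This factor `1` is inserted below so that, once the powers are generalised to symbols, the
  -- termwise identity is purely algebraic.
  have e3 : ‖ξ‖ ^ (1 - (d : ℝ) / 2) * ‖ξ‖ ^ ((d : ℝ) / 2 - 1) = 1 := by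
    rw [← Real.rpow_add hr]; simp
  change ((_ : ℝ) : ℂ) * (-Complex.I * ((‖ξ‖ / 2 : ℝ) : ℂ)) ^ (2 * m) = _
  rw [e1, e2, ← Complex.ofReal_mul, Complex.ofReal_inj, Real.mul_rpow (by norm_num) Real.pi_pos.le,
    show (m : ℝ) + ((d : ℝ) / 2 - 1) + 1 = m + d / 2 by ring]
  have h2 : (2 : ℝ) ^ ((d : ℝ) / 2) ≠ 0 := by positivity
  calc _ = 2 * Real.pi ^ ((d : ℝ) / 2) / (m.factorial * Real.Gamma (m + d / 2)) *
        ((-1) ^ m * (‖ξ‖ / 2) ^ (2 * m)) *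
          (‖ξ‖ ^ (1 - (d : ℝ) / 2) * ‖ξ‖ ^ ((d : ℝ) / 2 - 1)) := by rw [e3, mul_one]; rfl
    _ = _ := by
      generalize ‖ξ‖ ^ (1 - (d : ℝ) / 2) = A
      generalize ‖ξ‖ ^ ((d : ℝ) / 2 - 1) = B
      generalize Real.Gamma (m + (d : ℝ) / 2) = C
      generalize (2 : ℝ) ^ ((d : ℝ) / 2) = D at *
      field_simp

/-! ### Gamma and Beta integrals and Gauss's summation, in `ℝ≥0∞` so that sums and integrals commute
freely. -/

theorem lintegral_rpow_mul_exp_neg {a r : ℝ} (ha : 0 < a) (hr : 0 < r) :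
    ∫⁻ t in Set.Ioi (0 : ℝ), ENNReal.ofReal (t ^ (a - 1) * Real.exp (-(r * t))) =
      ENNReal.ofReal ((1 / r) ^ a * Real.Gamma a) := by
  have h := Real.integral_rpow_mul_exp_neg_mul_Ioi ha hr
  have hpos : 0 < (1 / r) ^ a * Real.Gamma a := by
    have := Real.Gamma_pos_of_pos ha
    positivity
  rw [← h, ofReal_integral_eq_lintegral_ofReal]
  · by_contra hi
    rw [integral_undef hi] at h
    linarith
  · filter_upwards [ae_restrict_mem measurableSet_Ioi] with t ht
    have := Set.mem_Ioi.1 ht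
    positivity

theorem lintegral_rpow_mul_one_sub_rpow {a b : ℝ} (ha : 0 < a) (hb : 0 < b) :
    ∫⁻ x in Set.Ioo (0 : ℝ) 1, ENNReal.ofReal (x ^ (a - 1) * (1 - x) ^ (b - 1)) =
      ENNReal.ofReal (Real.Gamma a * Real.Gamma b / Real.Gamma (a + b)) := by
  have h := ProbabilityTheory.lintegral_betaPDF_eq_one ha hb
  rw [ProbabilityTheory.lintegral_betaPDF] at h
  have hp := ProbabilityTheory.beta_pos ha hb
  simp_rw [mul_assoc] at h
  simp_rw [ENNReal.ofReal_mul (one_div_pos.2 hp).le] at h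
  rw [lintegral_const_mul' _ _ ENNReal.ofReal_ne_top] at h
  rw [one_div, ENNReal.ofReal_inv_of_pos hp] at h
  have := ENNReal.eq_inv_of_mul_eq_one_left ((mul_comm _ _).trans h)
  rw [this, inv_inv, ProbabilityTheory.beta]

/-- The binomial series: with `Γ(m+a)` as an Euler integral, the sum over `m` is `exp (t x)` under
the integral, leaving `∫ t^{a-1} e^{-(1-x)t} dt`. -/
theorem tsum_Gamma_mul_pow {a x : ℝ} (ha : 0 < a) (hx0 : 0 ≤ x) (hx1 : x < 1) :
    ∑' m : ℕ, ENNReal.ofReal (Real.Gamma (m + a) / m.factorial * x ^ m) =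
      ENNReal.ofReal (Real.Gamma a * (1 - x) ^ (-a)) := by
  have h1 : ∀ m : ℕ, ENNReal.ofReal (Real.Gamma (m + a) / m.factorial * x ^ m) =
      ∫⁻ t in Set.Ioi (0 : ℝ), ENNReal.ofReal (t ^ (a - 1) * Real.exp (-(1 * t))) *
        ENNReal.ofReal ((t * x) ^ m / m.factorial) := by
    intro m
    have := lintegral_rpow_mul_exp_neg (a := m + a) (r := 1) (by positivity) one_pos
    rw [show Real.Gamma (m + a) / m.factorial * x ^ m =
      (x ^ m / m.factorial) * ((1 / 1) ^ (m + a) * Real.Gamma (m + a)) by simp; ring,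
      ENNReal.ofReal_mul (by positivity), ← this, ← lintegral_const_mul' _ _ ENNReal.ofReal_ne_top]
    refine setLIntegral_congr_fun measurableSet_Ioi fun t ht => ?_
    have ht : 0 < t := ht
    rw [← ENNReal.ofReal_mul (by positivity), ← ENNReal.ofReal_mul (by positivity),
      show (m : ℝ) + a - 1 = m + (a - 1) by ring, Real.rpow_add ht, Real.rpow_natCast]
    congr 1
    ring
  simp_rw [h1]
  rw [← lintegral_tsum fun m => by fun_prop]
  rw [show Real.Gamma a * (1 - x) ^ (-a) = (1 / (1 - x)) ^ a * Real.Gamma a by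
    rw [one_div, Real.inv_rpow (by linarith), ← Real.rpow_neg (by linarith), mul_comm],
    ← lintegral_rpow_mul_exp_neg ha (by linarith)]
  refine setLIntegral_congr_fun measurableSet_Ioi fun t ht => ?_
  have ht : 0 < t := ht
  have hs : HasSum (fun m : ℕ => (t * x) ^ m / m.factorial) (Real.exp (t * x)) := by
    rw [Real.exp_eq_exp_ℝ]
    exact NormedSpace.expSeries_div_hasSum_exp (t * x)
  rw [ENNReal.tsum_mul_left, ← ENNReal.ofReal_tsum_of_nonneg (fun m => by positivity) hs.summable,
    hs.tsum_eq, ← ENNReal.ofReal_mul (by positivity), mul_assoc, ← Real.exp_add]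
  congr 3
  ring

/-- Gauss's summation of the hypergeometric series at `1`. -/
theorem tsum_Gamma_mul_Gamma_div {a b c : ℝ} (ha : 0 < a) (hb : 0 < b) (hc : a + b < c) :
    ∑' m : ℕ, ENNReal.ofReal
      (Real.Gamma (m + a) * Real.Gamma (m + b) / (m.factorial * Real.Gamma (m + c))) =
      ENNReal.ofReal (Real.Gamma a * Real.Gamma b * Real.Gamma (c - a - b) /
        (Real.Gamma (c - a) * Real.Gamma (c - b))) := by
  have hcb : 0 < Real.Gamma (c - b) := Real.Gamma_pos_of_pos (by linarith)
  have hGa : 0 < Real.Gamma a := Real.Gamma_pos_of_pos ha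
  -- `Γ(m+b)/Γ(m+c)` is a Beta integral with parameters `m+b` and `c-b`. Summing the binomial series
  -- inside leaves the Beta integral with parameters `b` and `c-a-b`, which converges because `a + b
  -- < c`.
  have h1 : ∀ m : ℕ, ENNReal.ofReal
      (Real.Gamma (m + a) * Real.Gamma (m + b) / (m.factorial * Real.Gamma (m + c))) =
      ∫⁻ x in Set.Ioo (0 : ℝ) 1, ENNReal.ofReal
        (x ^ (b - 1) * (1 - x) ^ (c - b - 1) / Real.Gamma (c - b)) *
          ENNReal.ofReal (Real.Gamma (m + a) / m.factorial * x ^ m) := by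
    intro m
    have hma : 0 < Real.Gamma (m + a) := Real.Gamma_pos_of_pos (by positivity)
    have := lintegral_rpow_mul_one_sub_rpow (a := m + b) (b := c - b) (by positivity) (by linarith)
    rw [show Real.Gamma (m + a) * Real.Gamma (m + b) / (m.factorial * Real.Gamma (m + c)) =
      (Real.Gamma (m + a) / (m.factorial * Real.Gamma (c - b))) *
        (Real.Gamma (m + b) * Real.Gamma (c - b) / Real.Gamma (m + b + (c - b))) by
        rw [show (m : ℝ) + b + (c - b) = m + c by ring]
        field_simp, ENNReal.ofReal_mul (by positivity), ← this,
        ← lintegral_const_mul' _ _ ENNReal.ofReal_ne_top]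
    refine setLIntegral_congr_fun measurableSet_Ioo fun x hx => ?_
    have h0 : 0 < x := hx.1
    have h1 : 0 < 1 - x := by linarith [hx.2]
    rw [← ENNReal.ofReal_mul (by positivity), ← ENNReal.ofReal_mul (by positivity),
      show (m : ℝ) + b - 1 = m + (b - 1) by ring, Real.rpow_add h0, Real.rpow_natCast]
    congr 1
    field_simp
  simp_rw [h1]
  rw [← lintegral_tsum fun m => by fun_prop]
  have h2 := lintegral_rpow_mul_one_sub_rpow (a := b) (b := c - a - b) hb (by linarith)
  rw [show Real.Gamma a * Real.Gamma b * Real.Gamma (c - a - b) /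
        (Real.Gamma (c - a) * Real.Gamma (c - b)) = (Real.Gamma a / Real.Gamma (c - b)) *
        (Real.Gamma b * Real.Gamma (c - a - b) / Real.Gamma (b + (c - a - b))) by
        rw [show b + (c - a - b) = c - a by ring]; ring, ENNReal.ofReal_mul (by positivity), ← h2,
        ← lintegral_const_mul' _ _ ENNReal.ofReal_ne_top]
  refine setLIntegral_congr_fun measurableSet_Ioo fun x hx => ?_
  have h0 : 0 < x := hx.1
  have h1 : 0 < 1 - x := by linarith [hx.2]
  rw [ENNReal.tsum_mul_left, tsum_Gamma_mul_pow ha h0.le hx.2, ← ENNReal.ofReal_mul (by positivity),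
    ← ENNReal.ofReal_mul (by positivity), show c - a - b - 1 = c - b - 1 + -a by ring,
    Real.rpow_add h1]
  congr 1
  ring

/-! ### The integral of the Riesz kernel over the sphere. -/

/-- The cone over a point lies in a line, a proper subspace since `d ≥ 2`. -/
theorem surf_singleton (hd : 2 ≤ d) (ω : Sph d) : surf d {ω} = 0 := by
  rw [Measure.toSphere_apply' _ (measurableSet_singleton _)]
  have hne : (Submodule.span ℝ {(ω : Euc d)}) ≠ ⊤ := by
    intro h
    have h1 := finrank_span_le_card (R := ℝ) ({(ω : Euc d)} : Set (Euc d))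
    rw [h, finrank_top, finrank_euclideanSpace_fin] at h1
    simp at h1
    omega
  have h0 := Measure.addHaar_submodule (volume : Measure (Euc d)) _ hne
  refine mul_eq_zero_of_right _ (measure_mono_null ?_ h0)
  rintro x ⟨r, -, y, hy, rfl⟩
  obtain ⟨z, hz, rfl⟩ := hy
  rw [Set.mem_singleton_iff.1 hz]
  exact Submodule.smul_mem _ _ (Submodule.mem_span_singleton_self _)

theorem norm_sub_sq_sphere (ω η : Sph d) :
    ‖(ω : Euc d) - η‖ ^ 2 = 2 - 2 * inner ℝ (ω : Euc d) (η : Euc d) := by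
  rw [norm_sub_sq_real, norm_eq_of_mem_sphere, norm_eq_of_mem_sphere]
  ring

/-- The value of `∫ ‖ω - η‖ ^ (2 s - d) dσ(η)`. -/
noncomputable def rieszConst (d : ℕ) (s : ℝ) : ℝ :=
  Real.pi ^ (((d : ℝ) - 1) / 2) * 2 ^ (2 * s - 1) * Real.Gamma (s - 1 / 2) /
    Real.Gamma ((d : ℝ) / 2 + s - 1)

theorem lintegral_sphere_exp [NeZero d] (ω : Sph d) {t : ℝ} (ht : 0 < t) :
    ∫⁻ η : Sph d, ENNReal.ofReal (Real.exp (2 * t * inner ℝ (ω : Euc d) (η : Euc d))) ∂(surf d) =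
      ∑' m : ℕ, ENNReal.ofReal (sphereTerm d t m) := by
  have h := hasSum_sphere_exp (𝕜 := ℝ) (ω : Euc d) (2 * t)
  simp only [norm_eq_of_mem_sphere, RCLike.ofReal_real_eq_id, id, ← Real.exp_eq_exp_ℝ] at h
  rw [show 2 * t * (1 / 2) = t by ring] at h
  have hn : ∀ m : ℕ, 0 ≤ sphereTerm d t m := fun m => by
    have hd : (1 : ℝ) ≤ d := by exact_mod_cast (NeZero.one_le : 1 ≤ d)
    have := Real.Gamma_pos_of_pos (show (0 : ℝ) < m + d / 2 by positivity)
    simp only [sphereTerm, RCLike.ofReal_real_eq_id, id]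
    positivity
  rw [← ENNReal.ofReal_tsum_of_nonneg hn h.summable, h.tsum_eq, ofReal_integral_eq_lintegral_ofReal]
  · exact (by fun_prop : Continuous fun η : Sph d =>
      Real.exp (2 * t * inner ℝ (ω : Euc d) (η : Euc d))).integrable_of_hasCompactSupport
      (HasCompactSupport.of_compactSpace _)
  · exact .of_forall fun η => (Real.exp_pos _).le

/-- Gauss's value at `a = d/4 - s/2`, `b = a + 1/2`, `c = d/2`, simplified by Legendre duplication
in the numerator and in the denominator. -/
theorem rieszConst_aux {s : ℝ} (hs : 1 / 2 < s) (hs' : s < (d : ℝ) / 2) :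
    Real.pi ^ (((d : ℝ) - 1) / 2) * (Real.Gamma (d / 4 - s / 2) * Real.Gamma (d / 4 - s / 2 + 1 / 2) *
      Real.Gamma (d / 2 - (d / 4 - s / 2) - (d / 4 - s / 2 + 1 / 2)) /
      (Real.Gamma (d / 2 - (d / 4 - s / 2)) * Real.Gamma (d / 2 - (d / 4 - s / 2 + 1 / 2)))) =
      rieszConst d s * Real.Gamma (d / 2 - s) := by
  have h1 := Real.Gamma_mul_Gamma_add_half ((d : ℝ) / 4 - s / 2)
  have h2 := Real.Gamma_mul_Gamma_add_half ((d : ℝ) / 4 + s / 2 - 1 / 2)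
  rw [show 2 * ((d : ℝ) / 4 - s / 2) = d / 2 - s by ring] at h1
  rw [show (d : ℝ) / 4 + s / 2 - 1 / 2 + 1 / 2 = d / 4 + s / 2 by ring,
    show 2 * ((d : ℝ) / 4 + s / 2 - 1 / 2) = d / 2 + s - 1 by ring, mul_comm] at h2
  rw [h1, show (d : ℝ) / 2 - (d / 4 - s / 2) = d / 4 + s / 2 by ring,
    show (d : ℝ) / 2 - (d / 4 - s / 2 + 1 / 2) = d / 4 + s / 2 - 1 / 2 by ring, h2, rieszConst,
    show (d : ℝ) / 4 + s / 2 - (d / 4 - s / 2 + 1 / 2) = s - 1 / 2 by ring]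
  have e : (2 : ℝ) ^ (1 - ((d : ℝ) / 2 - s)) = 2 ^ (2 * s - 1) * 2 ^ (1 - ((d : ℝ) / 2 + s - 1)) := by
    rw [← Real.rpow_add (by norm_num)]
    congr 1; ring
  have hG : 0 < Real.Gamma (d / 2 + s - 1) := Real.Gamma_pos_of_pos (by linarith)
  have hq : (0 : ℝ) < 2 ^ (1 - ((d : ℝ) / 2 + s - 1)) := by positivity
  have hpi : 0 < √Real.pi := Real.sqrt_pos.2 Real.pi_pos
  rw [e]
  field_simp

/-- Since `|ω-η|² = 2 - 2⟨ω,η⟩`, the kernel times `Γ(d/2-s)` is `∫ t^{d/2-s-1} e^{-2t} e^{2t⟨ω,η⟩}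
dt`. Integrating the series of `∫ e^{2t⟨ω,η⟩} dσ(η)` in `t` gives a hypergeometric series at `1`,
convergent because `c - a - b = s - 1/2 > 0`. -/
theorem lintegral_riesz_sphere (hd : 2 ≤ d) {s : ℝ} (hs : 1 / 2 < s) (hs' : s < (d : ℝ) / 2)
    (ω : Sph d) :
    ∫⁻ η : Sph d, ENNReal.ofReal (‖(ω : Euc d) - η‖ ^ (2 * s - d)) ∂(surf d) =
      ENNReal.ofReal (rieszConst d s) := by
  have : NeZero d := ⟨by omega⟩
  have hβ : 0 < (d : ℝ) / 2 - s := by linarith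
  have hG := Real.Gamma_pos_of_pos hβ
  have key : ENNReal.ofReal (Real.Gamma (d / 2 - s)) *
      ∫⁻ η : Sph d, ENNReal.ofReal (‖(ω : Euc d) - η‖ ^ (2 * s - d)) ∂(surf d) =
      ENNReal.ofReal (rieszConst d s * Real.Gamma (d / 2 - s)) := by
    rw [← rieszConst_aux hs hs', ENNReal.ofReal_mul (by positivity),
      ← tsum_Gamma_mul_Gamma_div (by linarith) (by linarith) (by linarith),
      ← lintegral_const_mul' _ _ ENNReal.ofReal_ne_top, ← ENNReal.tsum_mul_left]
    have h1 : ∀ᵐ η : Sph d ∂(surf d), ENNReal.ofReal (Real.Gamma (d / 2 - s)) *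
        ENNReal.ofReal (‖(ω : Euc d) - η‖ ^ (2 * s - d)) =
        ∫⁻ t in Set.Ioi (0 : ℝ), ENNReal.ofReal (t ^ ((d : ℝ) / 2 - s - 1) * Real.exp (-(2 * t))) *
          ENNReal.ofReal (Real.exp (2 * t * inner ℝ (ω : Euc d) (η : Euc d))) := by
      have : ∀ᵐ η : Sph d ∂(surf d), η ≠ ω := by
        rw [ae_iff]; simpa using surf_singleton hd ω
      filter_upwards [this] with η hη
      have hpos : 0 < ‖(ω : Euc d) - η‖ :=
        norm_pos_iff.2 (sub_ne_zero.2 fun h => hη (Subtype.ext h.symm))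
      rw [← ENNReal.ofReal_mul hG.le]
      have := lintegral_rpow_mul_exp_neg hβ (pow_pos hpos 2)
      rw [show Real.Gamma (d / 2 - s) * ‖(ω : Euc d) - η‖ ^ (2 * s - d) =
        (1 / ‖(ω : Euc d) - η‖ ^ 2) ^ ((d : ℝ) / 2 - s) * Real.Gamma (d / 2 - s) by
          rw [one_div, Real.inv_rpow (by positivity), ← Real.rpow_natCast, ← Real.rpow_mul hpos.le,
            ← Real.rpow_neg hpos.le, mul_comm]
          congr 2
          push_cast; ring, ← this]
      refine setLIntegral_congr_fun measurableSet_Ioi fun t ht => ?_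
      have ht : 0 < t := ht
      rw [← ENNReal.ofReal_mul (by positivity), mul_assoc, ← Real.exp_add, norm_sub_sq_sphere]
      congr 3
      ring
    rw [lintegral_congr_ae h1, lintegral_lintegral_swap (by fun_prop)]
    have h2 : ∀ t ∈ Set.Ioi (0 : ℝ), ∫⁻ η : Sph d,
        ENNReal.ofReal (t ^ ((d : ℝ) / 2 - s - 1) * Real.exp (-(2 * t))) *
          ENNReal.ofReal (Real.exp (2 * t * inner ℝ (ω : Euc d) (η : Euc d))) ∂(surf d) =
        ∑' m : ℕ, ENNReal.ofReal (2 * Real.pi ^ ((d : ℝ) / 2) /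
          (m.factorial * Real.Gamma (m + d / 2))) *
          ENNReal.ofReal (t ^ ((2 * m + (d / 2 - s)) - 1 : ℝ) * Real.exp (-(2 * t))) := by
      intro t ht
      have ht : 0 < t := ht
      rw [lintegral_const_mul' _ _ ENNReal.ofReal_ne_top, lintegral_sphere_exp ω ht,
        ← ENNReal.tsum_mul_left]
      congr 1
      ext m
      have := Real.Gamma_pos_of_pos (show (0 : ℝ) < m + d / 2 by
        have : (2 : ℝ) ≤ d := by exact_mod_cast hd
        positivity)
      rw [← ENNReal.ofReal_mul (by positivity), ← ENNReal.ofReal_mul (by positivity),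
        show (2 * m + (d / 2 - s)) - 1 = ((2 * m : ℕ) : ℝ) + ((d : ℝ) / 2 - s - 1) by
          push_cast; ring, Real.rpow_add ht, Real.rpow_natCast]
      simp only [sphereTerm, RCLike.ofReal_real_eq_id, id]
      congr 1
      ring
    rw [setLIntegral_congr_fun measurableSet_Ioi h2, lintegral_tsum fun m => by fun_prop]
    congr 1
    ext m
    have hm := Real.Gamma_pos_of_pos (show (0 : ℝ) < m + d / 2 by
        have : (2 : ℝ) ≤ d := by exact_mod_cast hd
        positivity)
    rw [lintegral_const_mul' _ _ ENNReal.ofReal_ne_top,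
      lintegral_rpow_mul_exp_neg (by positivity) two_pos, ← ENNReal.ofReal_mul (by positivity),
      ← ENNReal.ofReal_mul (by positivity)]
    congr 1
    -- Duplication splits `Γ(2m + d/2 - s)` into the two Gamma factors of Gauss's series.
    have h3 := Real.Gamma_mul_Gamma_add_half (m + ((d : ℝ) / 4 - s / 2))
    rw [add_assoc, show 2 * (m + ((d : ℝ) / 4 - s / 2)) = 2 * m + (d / 2 - s) by ring] at h3
    rw [h3, show ((d : ℝ) - 1) / 2 = d / 2 - 1 / 2 by ring, Real.rpow_sub Real.pi_pos,
      ← Real.sqrt_eq_rpow, Real.rpow_sub two_pos, Real.rpow_one, one_div,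
      Real.inv_rpow two_pos.le]
    field_simp
  rw [mul_comm, ENNReal.ofReal_mul' hG.le] at key
  exact (ENNReal.mul_left_inj (by simpa using hG) ENNReal.ofReal_ne_top).1 key

/-- The substitution `t ↦ 1/t` reduces this superposition of heat kernels to a Gamma integral. It is
used with `a = d/2 - s` for the energy identity and with `a = s` for the Riesz kernel. -/
theorem integrableOn_and_integral_heat {a r : ℝ} (ha : 0 < a) (hr : 0 < r) :
    IntegrableOn (fun t : ℝ => t ^ ((d : ℝ) / 2 - a - 1) * ((Real.pi / t) ^ ((d : ℝ) / 2) *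
      Real.exp (-(r ^ 2 / (4 * t))))) (Set.Ioi 0) ∧
    ∫ t in Set.Ioi (0 : ℝ), t ^ ((d : ℝ) / 2 - a - 1) * ((Real.pi / t) ^ ((d : ℝ) / 2) *
      Real.exp (-(r ^ 2 / (4 * t)))) =
      Real.pi ^ ((d : ℝ) / 2) * Real.Gamma a * 4 ^ a * r ^ (-(2 * a)) := by
  have hval : ∫ t in Set.Ioi (0 : ℝ), t ^ ((d : ℝ) / 2 - a - 1) * ((Real.pi / t) ^ ((d : ℝ) / 2) *
      Real.exp (-(r ^ 2 / (4 * t)))) =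
      Real.pi ^ ((d : ℝ) / 2) * Real.Gamma a * 4 ^ a * r ^ (-(2 * a)) := by
    have h1 := Real.integral_rpow_mul_exp_neg_mul_Ioi ha (show 0 < r ^ 2 / 4 by positivity)
    rw [← integral_comp_rpow_Ioi _ (show (-1 : ℝ) ≠ 0 by norm_num)] at h1
    have h2 : (1 / (r ^ 2 / 4)) ^ a = 4 ^ a * r ^ (-(2 * a)) := by
      rw [one_div_div, Real.div_rpow (by norm_num) (by positivity), ← Real.rpow_natCast,
        ← Real.rpow_mul hr.le, Real.rpow_neg hr.le]
      push_cast; rfl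
    rw [h2] at h1
    rw [show Real.pi ^ ((d : ℝ) / 2) * Real.Gamma a * 4 ^ a * r ^ (-(2 * a)) =
      Real.pi ^ ((d : ℝ) / 2) * (4 ^ a * r ^ (-(2 * a)) * Real.Gamma a) by ring, ← h1,
      ← integral_const_mul]
    refine setIntegral_congr_fun measurableSet_Ioi fun t ht => ?_
    have ht : 0 < t := ht
    simp only [abs_neg, abs_one, one_mul, smul_eq_mul]
    rw [Real.div_rpow Real.pi_pos.le ht.le, ← Real.rpow_mul ht.le, Real.rpow_neg_one,
      show (d : ℝ) / 2 - a - 1 = d / 2 + (-1 - 1 + -1 * (a - 1)) by ring, Real.rpow_add ht (d / 2),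
      Real.rpow_add ht (-1 - 1)]
    have : t ^ ((d : ℝ) / 2) ≠ 0 := by positivity
    field_simp
  refine ⟨?_, hval⟩
  by_contra hi
  rw [integral_undef hi] at hval
  have := Real.Gamma_pos_of_pos ha
  have : 0 < Real.pi ^ ((d : ℝ) / 2) * Real.Gamma a * 4 ^ a * r ^ (-(2 * a)) := by positivity
  linarith

/-! ### The quadratic form of the Riesz kernel: sharp bound and equality case. -/

/-- On the diagonal the kernel has the default value `0 ^ (2s-d) = 0` instead of `∞`, so positivity
and the heat formula hold only off it. -/
theorem ae_ne_prod (hd : 2 ≤ d) : ∀ᵐ p : Sph d × Sph d ∂((surf d).prod (surf d)), p.1 ≠ p.2 := by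
  have hm : MeasurableSet {p : Sph d × Sph d | p.1 ≠ p.2} :=
    (isClosed_eq continuous_fst continuous_snd).measurableSet.compl
  refine (Measure.ae_prod_iff_ae_ae hm).2 (.of_forall fun ω => ?_)
  rw [ae_iff]
  simpa using surf_singleton hd ω

/-- The kernel `‖ω - η‖ ^ (2 s - d)` on the sphere. -/
noncomputable def rieszKer (d : ℕ) (s : ℝ) (p : Sph d × Sph d) : ℝ :=
  ‖(p.1 : Euc d) - p.2‖ ^ (2 * s - d)

theorem rieszKer_nonneg (s : ℝ) (p : Sph d × Sph d) : 0 ≤ rieszKer d s p :=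
  Real.rpow_nonneg (norm_nonneg _) _

@[fun_prop]
theorem measurable_rieszKer (s : ℝ) : Measurable (rieszKer d s) := by
  unfold rieszKer; fun_prop

theorem rieszKer_swap (s : ℝ) (p : Sph d × Sph d) : rieszKer d s p.swap = rieszKer d s p := by
  simp [rieszKer, norm_sub_rev]

theorem rieszConst_pos {s : ℝ} (hs : 1 / 2 < s) (hs' : s < (d : ℝ) / 2) : 0 < rieszConst d s := by
  have := Real.Gamma_pos_of_pos (show 0 < s - 1 / 2 by linarith)
  have := Real.Gamma_pos_of_pos (show 0 < (d : ℝ) / 2 + s - 1 by linarith)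
  unfold rieszConst
  positivity

theorem integrable_norm_sq {g : Sph d → ℂ} (hg : MemLp g 2 (surf d)) :
    Integrable (fun ω => ‖g ω‖ ^ 2) (surf d) :=
  (memLp_two_iff_integrable_sq_norm hg.1).1 hg

theorem integrable_and_integral_rieszKer_fst (hd : 2 ≤ d) {s : ℝ} (hs : 1 / 2 < s)
    (hs' : s < (d : ℝ) / 2) {g : Sph d → ℂ} (hg : MemLp g 2 (surf d)) :
    Integrable (fun p => rieszKer d s p * ‖g p.1‖ ^ 2) ((surf d).prod (surf d)) ∧
      ∫ p, rieszKer d s p * ‖g p.1‖ ^ 2 ∂((surf d).prod (surf d)) =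
        rieszConst d s * ∫ ω, ‖g ω‖ ^ 2 ∂(surf d) := by
  have hmeas : AEStronglyMeasurable (fun p => rieszKer d s p * ‖g p.1‖ ^ 2)
      ((surf d).prod (surf d)) :=
    (measurable_rieszKer s).aestronglyMeasurable.mul (hg.1.comp_fst.norm.pow 2)
  have h1 := integrable_norm_sq hg
  have hC := rieszConst_pos hs hs'
  have hl : ∫⁻ p, ENNReal.ofReal (rieszKer d s p * ‖g p.1‖ ^ 2) ∂((surf d).prod (surf d)) =
      ENNReal.ofReal (rieszConst d s * ∫ ω, ‖g ω‖ ^ 2 ∂(surf d)) := by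
    rw [lintegral_prod _ hmeas.aemeasurable.ennreal_ofReal, ENNReal.ofReal_mul hC.le,
      ofReal_integral_eq_lintegral_ofReal h1 (.of_forall fun ω => by positivity),
      ← lintegral_const_mul' _ _ ENNReal.ofReal_ne_top]
    refine lintegral_congr fun ω => ?_
    simp_rw [ENNReal.ofReal_mul (rieszKer_nonneg s _)]
    rw [lintegral_mul_const' _ _ ENNReal.ofReal_ne_top]
    congr 1
    exact lintegral_riesz_sphere hd hs hs' ω
  have hnn : 0 ≤ᵐ[(surf d).prod (surf d)] fun p => rieszKer d s p * ‖g p.1‖ ^ 2 :=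
    .of_forall fun p => mul_nonneg (rieszKer_nonneg s p) (by positivity)
  refine ⟨⟨hmeas, ?_⟩, ?_⟩
  · rw [hasFiniteIntegral_iff_ofReal hnn, hl]
    exact ENNReal.ofReal_lt_top
  · rw [integral_eq_lintegral_of_nonneg_ae hnn hmeas, hl, ENNReal.toReal_ofReal]
    exact mul_nonneg hC.le (integral_nonneg fun ω => by positivity)

theorem integrable_and_integral_rieszKer_snd (hd : 2 ≤ d) {s : ℝ} (hs : 1 / 2 < s)
    (hs' : s < (d : ℝ) / 2) {g : Sph d → ℂ} (hg : MemLp g 2 (surf d)) :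
    Integrable (fun p => rieszKer d s p * ‖g p.2‖ ^ 2) ((surf d).prod (surf d)) ∧
      ∫ p, rieszKer d s p * ‖g p.2‖ ^ 2 ∂((surf d).prod (surf d)) =
        rieszConst d s * ∫ ω, ‖g ω‖ ^ 2 ∂(surf d) := by
  obtain ⟨h1, h2⟩ := integrable_and_integral_rieszKer_fst hd hs hs' hg
  have e : ∀ p : Sph d × Sph d, rieszKer d s p * ‖g p.2‖ ^ 2 =
      rieszKer d s p.swap * ‖g p.swap.1‖ ^ 2 := fun p => by rw [rieszKer_swap]; rfl
  simp_rw [e]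
  exact ⟨h1.swap, by rw [← h2]; exact integral_prod_swap (fun p => rieszKer d s p * ‖g p.1‖ ^ 2)⟩

theorem integrable_rieszKer_mul_mul (hd : 2 ≤ d) {s : ℝ} (hs : 1 / 2 < s)
    (hs' : s < (d : ℝ) / 2) {g : Sph d → ℂ} (hg : MemLp g 2 (surf d)) :
    Integrable (fun p => (rieszKer d s p : ℂ) * (g p.1 * star (g p.2)))
      ((surf d).prod (surf d)) := by
  have h1 := (integrable_and_integral_rieszKer_fst hd hs hs' hg).1
  have h2 := (integrable_and_integral_rieszKer_snd hd hs hs' hg).1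
  refine (h1.add h2).mono' ?_ (.of_forall fun p => ?_)
  · exact (Complex.measurable_ofReal.comp (measurable_rieszKer s)).aestronglyMeasurable.mul
      (hg.1.comp_fst.mul (continuous_star.comp_aestronglyMeasurable hg.1.comp_snd))
  · simp only [norm_mul, Complex.norm_real, norm_star, Real.norm_eq_abs,
      abs_of_nonneg (rieszKer_nonneg s p), Pi.add_apply]
    rw [← mul_add]
    have h (a b : ℝ) : a * b ≤ a ^ 2 + b ^ 2 := by nlinarith [sq_nonneg (a + b), sq_nonneg (a - b)]
    exact mul_le_mul_of_nonneg_left (h _ _) (rieszKer_nonneg s p)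

/-- The quadratic form of the kernel `‖ω - η‖ ^ (2 s - d)`. -/
noncomputable def rieszForm (d : ℕ) (s : ℝ) (g : Sph d → ℂ) : ℂ :=
  ∫ p, (rieszKer d s p : ℂ) * (g p.1 * star (g p.2)) ∂((surf d).prod (surf d))

/-- Expand `|g(ω) - g(η)|²`; both square terms integrate to `K ‖g‖²` because the kernel has constant
marginals. This identity yields the sharp bound and its equality case together. -/
theorem integrable_and_rieszForm_re (hd : 2 ≤ d) {s : ℝ} (hs : 1 / 2 < s)
    (hs' : s < (d : ℝ) / 2) {g : Sph d → ℂ} (hg : MemLp g 2 (surf d)) :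
    Integrable (fun p => rieszKer d s p * ‖g p.1 - g p.2‖ ^ 2) ((surf d).prod (surf d)) ∧
    (rieszForm d s g).re = rieszConst d s * ∫ ω, ‖g ω‖ ^ 2 ∂(surf d) -
      (∫ p, rieszKer d s p * ‖g p.1 - g p.2‖ ^ 2 ∂((surf d).prod (surf d))) / 2 := by
  obtain ⟨h1, h1'⟩ := integrable_and_integral_rieszKer_fst hd hs hs' hg
  obtain ⟨h2, h2'⟩ := integrable_and_integral_rieszKer_snd hd hs hs' hg
  have h3 := integrable_rieszKer_mul_mul hd hs hs' hg
  have e : ∀ p : Sph d × Sph d, rieszKer d s p * ‖g p.1 - g p.2‖ ^ 2 =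
      rieszKer d s p * ‖g p.1‖ ^ 2 + rieszKer d s p * ‖g p.2‖ ^ 2 -
        2 * ((rieszKer d s p : ℂ) * (g p.1 * star (g p.2))).re := fun p => by
    rw [Complex.re_ofReal_mul, Complex.sq_norm, Complex.sq_norm, Complex.sq_norm,
      Complex.normSq_sub]
    simp only [Complex.star_def]
    ring
  simp_rw [e]
  have h3' : Integrable (fun p => ((rieszKer d s p : ℂ) * (g p.1 * star (g p.2))).re)
      ((surf d).prod (surf d)) := h3.re
  have h12 : Integrable (fun p => rieszKer d s p * ‖g p.1‖ ^ 2 + rieszKer d s p * ‖g p.2‖ ^ 2)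
      ((surf d).prod (surf d)) := h1.add h2
  refine ⟨h12.sub (h3'.const_mul 2), ?_⟩
  rw [integral_sub h12 (h3'.const_mul 2), integral_add h1 h2, h1', h2',
    integral_const_mul, rieszForm]
  have : ∫ p, ((rieszKer d s p : ℂ) * (g p.1 * star (g p.2))).re ∂((surf d).prod (surf d)) =
    (∫ p, ((rieszKer d s p : ℂ) * (g p.1 * star (g p.2))) ∂((surf d).prod (surf d))).re :=
    integral_re h3
  rw [this]
  ring

theorem rieszForm_re_le (hd : 2 ≤ d) {s : ℝ} (hs : 1 / 2 < s)
    (hs' : s < (d : ℝ) / 2) {g : Sph d → ℂ} (hg : MemLp g 2 (surf d)) :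
    (rieszForm d s g).re ≤ rieszConst d s * ∫ ω, ‖g ω‖ ^ 2 ∂(surf d) := by
  rw [(integrable_and_rieszForm_re hd hs hs' hg).2]
  have : 0 ≤ ∫ p, rieszKer d s p * ‖g p.1 - g p.2‖ ^ 2 ∂((surf d).prod (surf d)) :=
    integral_nonneg fun p => mul_nonneg (rieszKer_nonneg s p) (by positivity)
  linarith

theorem rieszForm_const (hd : 2 ≤ d) {s : ℝ} (hs : 1 / 2 < s) (hs' : s < (d : ℝ) / 2) (c : ℂ) :
    (rieszForm d s fun _ => c).re = rieszConst d s * ∫ _, ‖c‖ ^ 2 ∂(surf d) := by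
  rw [(integrable_and_rieszForm_re hd hs hs' (memLp_const c)).2]
  simp

/-- The defect integral vanishes and the kernel is positive off the null diagonal, so `g(η) = g(ω)`
for almost every pair; one good `ω` supplies the constant. -/
theorem ae_eq_const_of_rieszForm_eq (hd : 2 ≤ d) {s : ℝ} (hs : 1 / 2 < s)
    (hs' : s < (d : ℝ) / 2) {g : Sph d → ℂ} (hg : MemLp g 2 (surf d))
    (h : (rieszForm d s g).re = rieszConst d s * ∫ ω, ‖g ω‖ ^ 2 ∂(surf d)) :
    ∃ c : ℂ, g =ᵐ[surf d] fun _ => c := by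
  obtain ⟨h1, h2⟩ := integrable_and_rieszForm_re hd hs hs' hg
  have h0 : ∫ p, rieszKer d s p * ‖g p.1 - g p.2‖ ^ 2 ∂((surf d).prod (surf d)) = 0 := by
    linarith
  rw [integral_eq_zero_iff_of_nonneg
    (fun p => mul_nonneg (rieszKer_nonneg s p) (by positivity)) h1] at h0
  have h3 : ∀ᵐ p ∂((surf d).prod (surf d)), g p.2 = g p.1 := by
    filter_upwards [h0, ae_ne_prod hd] with p hp hne
    have hpos : 0 < rieszKer d s p :=
      Real.rpow_pos_of_pos (norm_pos_iff.2 (sub_ne_zero.2 fun h => hne (Subtype.ext h))) _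
    have h4 : rieszKer d s p * ‖g p.1 - g p.2‖ ^ 2 = 0 := hp
    have h5 := (mul_eq_zero.1 h4).resolve_left hpos.ne'
    have h6 : g p.1 - g p.2 = 0 := by simpa using h5
    exact (sub_eq_zero.1 h6).symm
  have : NeZero d := ⟨by omega⟩
  have hne : surf d ≠ 0 := Measure.toSphere_ne_zero _
  have : (ae (surf d)).NeBot := ae_neBot.2 hne
  obtain ⟨ω, hω⟩ := (Measure.ae_ae_of_ae_prod h3).exists
  exact ⟨g ω, hω⟩

/-! ### The energy identity for the Fourier transform of `g dσ`. -/

/-- The Fourier transform of the measure `g dσ`. -/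
noncomputable def sphFT (g : Sph d → ℂ) (ξ : Euc d) : ℂ :=
  ∫ ω : Sph d, Complex.exp (-Complex.I * (inner ℝ (ω : Euc d) ξ : ℝ)) * g ω ∂(surf d)

theorem norm_exp_neg_I_mul (r : ℝ) : ‖Complex.exp (-Complex.I * (r : ℂ))‖ = 1 := by
  rw [Complex.norm_exp]; simp

theorem star_exp_neg_I_mul (r : ℝ) :
    star (Complex.exp (-Complex.I * (r : ℂ))) = Complex.exp (Complex.I * (r : ℂ)) := by
  rw [Complex.star_def, ← Complex.exp_conj]; simp

theorem integrable_exp_mul {g : Sph d → ℂ} (hg : Integrable g (surf d)) (ξ : Euc d) :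
    Integrable (fun ω : Sph d =>
      Complex.exp (-Complex.I * (inner ℝ (ω : Euc d) ξ : ℝ)) * g ω) (surf d) := by
  refine hg.norm.mono' ((by fun_prop : Continuous fun ω : Sph d =>
      Complex.exp (-Complex.I * (inner ℝ (ω : Euc d) ξ : ℝ))).aestronglyMeasurable.mul hg.1)
    (.of_forall fun ω => ?_)
  rw [norm_mul, norm_exp_neg_I_mul, one_mul]

theorem norm_sphFT_le (g : Sph d → ℂ) (ξ : Euc d) :
    ‖sphFT g ξ‖ ≤ ∫ ω, ‖g ω‖ ∂(surf d) := by
  refine (norm_integral_le_integral_norm _).trans_eq ?_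
  simp_rw [norm_mul, norm_exp_neg_I_mul, one_mul]

theorem continuous_sphFT {g : Sph d → ℂ} (hg : Integrable g (surf d)) :
    Continuous (sphFT g) := by
  refine continuous_of_dominated (bound := fun ω => ‖g ω‖) (fun ξ => (integrable_exp_mul hg ξ).1)
    (fun ξ => .of_forall fun ω => ?_) hg.norm (.of_forall fun ω => by fun_prop)
  rw [norm_mul, norm_exp_neg_I_mul, one_mul]

theorem sphFT_mul_star {g : Sph d → ℂ} (ξ : Euc d) :
    sphFT g ξ * star (sphFT g ξ) = ∫ p : Sph d × Sph d,
      Complex.exp (-Complex.I * (inner ℝ ((p.1 : Euc d) - p.2) ξ : ℝ)) * (g p.1 * star (g p.2))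
        ∂((surf d).prod (surf d)) := by
  have h : star (sphFT g ξ) = ∫ ω : Sph d,
      star (Complex.exp (-Complex.I * (inner ℝ (ω : Euc d) ξ : ℝ)) * g ω) ∂(surf d) :=
    integral_conj.symm
  rw [h, sphFT, ← integral_prod_mul]
  refine integral_congr_ae (.of_forall fun p => ?_)
  simp only [star_mul', star_exp_neg_I_mul]
  rw [inner_sub_left, Complex.ofReal_sub, mul_sub, sub_eq_add_neg (-Complex.I * _), Complex.exp_add,
    show -(-Complex.I * ((inner ℝ (p.2 : Euc d) ξ : ℝ) : ℂ)) =
      Complex.I * ((inner ℝ (p.2 : Euc d) ξ : ℝ) : ℂ) by ring]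
  ring

theorem integral_gaussian_mul_exp {t : ℝ} (ht : 0 < t) (w : Euc d) :
    ∫ ξ : Euc d, ((Real.exp (-(t * ‖ξ‖ ^ 2)) : ℝ) : ℂ) *
      Complex.exp (-Complex.I * (inner ℝ w ξ : ℝ)) =
      (((Real.pi / t) ^ ((d : ℝ) / 2) * Real.exp (-(‖w‖ ^ 2 / (4 * t))) : ℝ) : ℂ) := by
  have h := GaussianFourier.integral_cexp_neg_mul_sq_norm_add (V := Euc d) (b := t) (by simpa)
    (-Complex.I) w
  convert h using 1
  · congr 1
    ext x
    push_cast
    rw [← Complex.exp_add]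
    ring_nf
  · rw [finrank_euclideanSpace_fin]
    push_cast
    rw [Complex.ofReal_cpow (by positivity)]
    push_cast
    congr 2
    simp [neg_div]

theorem integrable_gaussian {t : ℝ} (ht : 0 < t) :
    Integrable fun ξ : Euc d => Real.exp (-(t * ‖ξ‖ ^ 2)) := by
  have h := integral_gaussian_mul_exp ht (0 : Euc d)
  by_contra hi
  have hi' : ¬ Integrable fun ξ : Euc d => ((Real.exp (-(t * ‖ξ‖ ^ 2)) : ℝ) : ℂ) *
      Complex.exp (-Complex.I * (inner ℝ (0 : Euc d) ξ : ℝ)) := by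
    simp only [inner_zero_left, Complex.ofReal_zero, mul_zero, Complex.exp_zero, mul_one]
    exact fun h' => hi h'.re
  rw [integral_undef hi'] at h
  have : 0 < (Real.pi / t) ^ ((d : ℝ) / 2) * Real.exp (-(‖(0 : Euc d)‖ ^ 2 / (4 * t))) := by
    positivity
  rw [eq_comm, Complex.ofReal_eq_zero] at h
  linarith

theorem integrable_mul_star {g : Sph d → ℂ} (hg : Integrable g (surf d)) :
    Integrable (fun p : Sph d × Sph d => g p.1 * star (g p.2)) ((surf d).prod (surf d)) :=
  hg.mul_prod (g := fun ω => star (g ω))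
    (hg.norm.mono' (continuous_star.comp_aestronglyMeasurable hg.1)
      (.of_forall fun _ => (norm_star _).le))

/-- The Gaussian weight makes Fubini in `(ξ, ω, η)` absolutely convergent, which the weight
`|ξ|^{-2s}` does not, as it is not integrable at infinity. -/
theorem gaussian_energy {g : Sph d → ℂ} (hg : Integrable g (surf d)) {t : ℝ} (ht : 0 < t) :
    Integrable (fun ξ : Euc d => Real.exp (-(t * ‖ξ‖ ^ 2)) * ‖sphFT g ξ‖ ^ 2) ∧
    ((∫ ξ : Euc d, Real.exp (-(t * ‖ξ‖ ^ 2)) * ‖sphFT g ξ‖ ^ 2 : ℝ) : ℂ) =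
      ∫ p : Sph d × Sph d, (((Real.pi / t) ^ ((d : ℝ) / 2) *
        Real.exp (-(‖(p.1 : Euc d) - p.2‖ ^ 2 / (4 * t))) : ℝ) : ℂ) * (g p.1 * star (g p.2))
        ∂((surf d).prod (surf d)) := by
  constructor
  · refine ((integrable_gaussian ht).mul_const ((∫ ω, ‖g ω‖ ∂(surf d)) ^ 2)).mono'
      (by have := continuous_sphFT hg; exact Continuous.aestronglyMeasurable (by fun_prop))
      (.of_forall fun ξ => ?_)
    rw [Real.norm_of_nonneg (by positivity)]
    gcongr
    exact norm_sphFT_le g ξ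
  · rw [← integral_complex_ofReal]
    have h1 : ∀ ξ : Euc d, ((Real.exp (-(t * ‖ξ‖ ^ 2)) * ‖sphFT g ξ‖ ^ 2 : ℝ) : ℂ) =
        ∫ p : Sph d × Sph d, ((Real.exp (-(t * ‖ξ‖ ^ 2)) : ℝ) : ℂ) *
          (Complex.exp (-Complex.I * (inner ℝ ((p.1 : Euc d) - p.2) ξ : ℝ)) *
            (g p.1 * star (g p.2))) ∂((surf d).prod (surf d)) := by
      intro ξ
      rw [integral_const_mul, ← sphFT_mul_star, Complex.star_def, Complex.mul_conj,
        Complex.normSq_eq_norm_sq]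
      push_cast
      rfl
    simp_rw [h1]
    rw [integral_integral_swap]
    · refine integral_congr_ae (.of_forall fun p => ?_)
      simp only
      rw [← integral_gaussian_mul_exp ht, ← integral_mul_const]
      simp_rw [mul_assoc]
    · refine ((integrable_gaussian ht).norm.mul_prod (integrable_mul_star hg).norm).mono' ?_
        (.of_forall fun q => ?_)
      · refine (Continuous.aestronglyMeasurable (by fun_prop)).mul
          ((Continuous.aestronglyMeasurable (by fun_prop)).mul
          (integrable_mul_star hg).1.comp_snd)
      · simp only [Function.uncurry, norm_mul, norm_exp_neg_I_mul, one_mul, Complex.norm_real,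
          norm_star]
        exact le_rfl

/-- The constant relating the energy `∫ |ξ|^{-2s} |(g dσ)^|²` and the form `rieszForm`. -/
noncomputable def energyConst (d : ℕ) (s : ℝ) : ℝ :=
  Real.pi ^ ((d : ℝ) / 2) * Real.Gamma (d / 2 - s) * 4 ^ ((d : ℝ) / 2 - s) / Real.Gamma s

theorem gaussian_superposition {s : ℝ} (hs : 0 < s) {ξ : Euc d} (hξ : ξ ≠ 0) :
    ENNReal.ofReal (‖ξ‖ ^ (-(2 * s))) = (ENNReal.ofReal (Real.Gamma s))⁻¹ *
      ∫⁻ t in Set.Ioi (0 : ℝ), ENNReal.ofReal (t ^ (s - 1) * Real.exp (-(t * ‖ξ‖ ^ 2))) := by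
  have hr : 0 < ‖ξ‖ := norm_pos_iff.2 hξ
  have hG := Real.Gamma_pos_of_pos hs
  have h := lintegral_rpow_mul_exp_neg hs (pow_pos hr 2)
  simp_rw [mul_comm _ (‖ξ‖ ^ 2), h]
  rw [← ENNReal.ofReal_inv_of_pos hG, ← ENNReal.ofReal_mul (by positivity), one_div,
    Real.inv_rpow (by positivity), ← Real.rpow_natCast, ← Real.rpow_mul hr.le,
    ← Real.rpow_neg hr.le]
  congr 1
  push_cast
  field_simp

/-- The `t`-integrand is a nonnegative kernel times `g(ω) conj g(η)`, so absolute integrability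
reduces to that of the integrated kernel, `integrable_rieszKer_mul_mul`. -/
theorem integrable_heat_mul (hd : 2 ≤ d) {s : ℝ} (hs : 1 / 2 < s) (hs' : s < (d : ℝ) / 2)
    {g : Sph d → ℂ} (hg : MemLp g 2 (surf d)) :
    Integrable (fun q : ℝ × (Sph d × Sph d) => ((q.1 ^ (s - 1) * ((Real.pi / q.1) ^ ((d : ℝ) / 2) *
        Real.exp (-(‖(q.2.1 : Euc d) - q.2.2‖ ^ 2 / (4 * q.1)))) : ℝ) : ℂ) *
          (g q.2.1 * star (g q.2.2)))
      ((volume.restrict (Set.Ioi 0)).prod ((surf d).prod (surf d))) ∧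
    ∀ᵐ p ∂((surf d).prod (surf d)), ∫ t in Set.Ioi (0 : ℝ),
      ((t ^ (s - 1) * ((Real.pi / t) ^ ((d : ℝ) / 2) *
        Real.exp (-(‖(p.1 : Euc d) - p.2‖ ^ 2 / (4 * t)))) : ℝ) : ℂ) * (g p.1 * star (g p.2)) =
      ((energyConst d s * Real.Gamma s : ℝ) : ℂ) *
        ((rieszKer d s p : ℂ) * (g p.1 * star (g p.2))) := by
  have hgi : Integrable g (surf d) := hg.integrable (by norm_num)
  have ha : 0 < (d : ℝ) / 2 - s := by linarith
  have hG := Real.Gamma_pos_of_pos (show 0 < s by linarith)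
  have hheat : ∀ p : Sph d × Sph d, p.1 ≠ p.2 →
      IntegrableOn (fun t : ℝ => t ^ (s - 1) * ((Real.pi / t) ^ ((d : ℝ) / 2) *
      Real.exp (-(‖(p.1 : Euc d) - p.2‖ ^ 2 / (4 * t))))) (Set.Ioi 0) ∧
      ∫ t in Set.Ioi (0 : ℝ), t ^ (s - 1) * ((Real.pi / t) ^ ((d : ℝ) / 2) *
      Real.exp (-(‖(p.1 : Euc d) - p.2‖ ^ 2 / (4 * t)))) =
        energyConst d s * Real.Gamma s * rieszKer d s p := by
    intro p hp
    have := integrableOn_and_integral_heat (d := d) ha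
      (norm_pos_iff.2 (sub_ne_zero.2 fun h => hp (Subtype.ext h)))
    rw [show (d : ℝ) / 2 - (d / 2 - s) - 1 = s - 1 by ring,
      show -(2 * ((d : ℝ) / 2 - s)) = 2 * s - d by ring] at this
    refine ⟨this.1, this.2.trans ?_⟩
    rw [energyConst, rieszKer, div_mul_cancel₀ _ hG.ne']
  constructor
  · have hm : AEStronglyMeasurable (fun q : ℝ × (Sph d × Sph d) =>
        ((q.1 ^ (s - 1) * ((Real.pi / q.1) ^ ((d : ℝ) / 2) *
        Real.exp (-(‖(q.2.1 : Euc d) - q.2.2‖ ^ 2 / (4 * q.1)))) : ℝ) : ℂ) *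
          (g q.2.1 * star (g q.2.2)))
        ((volume.restrict (Set.Ioi 0)).prod ((surf d).prod (surf d))) :=
      (Measurable.aestronglyMeasurable (by fun_prop)).mul (integrable_mul_star hgi).1.comp_snd
    rw [integrable_prod_iff' hm]
    constructor
    · filter_upwards [ae_ne_prod hd] with p hp
      exact ((hheat p hp).1.ofReal (𝕜 := ℂ)).mul_const _
    · have h3 := ((integrable_rieszKer_mul_mul hd hs hs' hg).norm.const_mul
        (energyConst d s * Real.Gamma s))
      refine h3.congr ?_
      filter_upwards [ae_ne_prod hd] with p hp
      simp only [norm_mul, Complex.norm_real]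
      rw [integral_mul_const, Real.norm_of_nonneg (rieszKer_nonneg s p), ← mul_assoc,
        ← (hheat p hp).2]
      congr 1
      refine setIntegral_congr_fun measurableSet_Ioi fun t ht => ?_
      have ht : 0 < t := ht
      simp only [← norm_mul]
      rw [Real.norm_of_nonneg (by positivity)]
  · filter_upwards [ae_ne_prod hd] with p hp
    rw [integral_mul_const, integral_complex_ofReal, (hheat p hp).2]
    push_cast
    ring

/-- Tonelli inserts the superposition of `|ξ|^{-2s}`, `gaussian_energy` evaluates each Gaussian
slice, and integrating in `t` rebuilds the Riesz kernel. Finiteness of the left side is part of the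
conclusion. -/
theorem lintegral_sphFT_sq (hd : 2 ≤ d) {s : ℝ} (hs : 1 / 2 < s) (hs' : s < (d : ℝ) / 2)
    {g : Sph d → ℂ} (hg : MemLp g 2 (surf d)) :
    ∫⁻ ξ : Euc d, ENNReal.ofReal (‖ξ‖ ^ (-(2 * s))) * ‖sphFT g ξ‖ₑ ^ 2 =
      ENNReal.ofReal (energyConst d s * (rieszForm d s g).re) := by
  have hgi : Integrable g (surf d) := hg.integrable (by norm_num)
  have hs0 : 0 < s := by linarith
  have hG := Real.Gamma_pos_of_pos hs0
  have : NeZero d := ⟨by omega⟩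
  have hcont := continuous_sphFT hgi
  obtain ⟨hint, hval⟩ := integrable_heat_mul hd hs hs' hg
  set G : ℝ → ℝ := fun t => ∫ ξ : Euc d, Real.exp (-(t * ‖ξ‖ ^ 2)) * ‖sphFT g ξ‖ ^ 2 with hGdef
  have hG0 : ∀ t, 0 ≤ G t := fun t => integral_nonneg fun ξ => by positivity
  have hGt : ∀ t ∈ Set.Ioi (0 : ℝ), ((t ^ (s - 1) * G t : ℝ) : ℂ) = ∫ p : Sph d × Sph d,
      ((t ^ (s - 1) * ((Real.pi / t) ^ ((d : ℝ) / 2) *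
        Real.exp (-(‖(p.1 : Euc d) - p.2‖ ^ 2 / (4 * t)))) : ℝ) : ℂ) * (g p.1 * star (g p.2))
          ∂((surf d).prod (surf d)) := by
    intro t ht
    rw [Complex.ofReal_mul, hGdef, (gaussian_energy hgi ht).2, ← integral_const_mul]
    refine integral_congr_ae (.of_forall fun p => ?_)
    simp only [Complex.ofReal_mul]
    ring
  have h1 : ∫⁻ ξ : Euc d, ENNReal.ofReal (‖ξ‖ ^ (-(2 * s))) * ‖sphFT g ξ‖ₑ ^ 2 =
      (ENNReal.ofReal (Real.Gamma s))⁻¹ *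
        ∫⁻ t in Set.Ioi (0 : ℝ), ENNReal.ofReal (t ^ (s - 1) * G t) := by
    have e1 : ∀ᵐ ξ : Euc d, ENNReal.ofReal (‖ξ‖ ^ (-(2 * s))) * ‖sphFT g ξ‖ₑ ^ 2 =
        (ENNReal.ofReal (Real.Gamma s))⁻¹ * ∫⁻ t in Set.Ioi (0 : ℝ),
          ENNReal.ofReal (t ^ (s - 1) * Real.exp (-(t * ‖ξ‖ ^ 2))) * ‖sphFT g ξ‖ₑ ^ 2 := by
      filter_upwards [Measure.ae_ne volume (0 : Euc d)] with ξ hξ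
      rw [gaussian_superposition hs0 hξ, lintegral_mul_const' _ _ (by simp), mul_assoc]
    rw [lintegral_congr_ae e1, lintegral_const_mul' _ _ (by simpa using hG),
      lintegral_lintegral_swap]
    · congr 1
      refine setLIntegral_congr_fun measurableSet_Ioi fun t ht => ?_
      have ht' : 0 < t := ht
      rw [ENNReal.ofReal_mul (by positivity), hGdef,
        ofReal_integral_eq_lintegral_ofReal (gaussian_energy hgi ht').1
        (.of_forall fun ξ => by positivity), ← lintegral_const_mul' _ _ ENNReal.ofReal_ne_top]
      refine lintegral_congr fun ξ => ?_
      rw [ENNReal.ofReal_mul (by positivity), ENNReal.ofReal_mul (by positivity), mul_assoc,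
        ENNReal.ofReal_pow (norm_nonneg _), ofReal_norm]
    · have := hcont.measurable
      fun_prop
  have hi1 : Integrable (fun t => ((t ^ (s - 1) * G t : ℝ) : ℂ)) (volume.restrict (Set.Ioi 0)) := by
    refine hint.integral_prod_left.congr ?_
    filter_upwards [ae_restrict_mem measurableSet_Ioi] with t ht
    exact (hGt t ht).symm
  have hi2 : Integrable (fun t => t ^ (s - 1) * G t) (volume.restrict (Set.Ioi 0)) := by
    simpa using hi1.re
  have h2 : ((∫ t in Set.Ioi (0 : ℝ), t ^ (s - 1) * G t : ℝ) : ℂ) =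
      ((energyConst d s * Real.Gamma s : ℝ) : ℂ) * rieszForm d s g := by
    rw [← integral_complex_ofReal, setIntegral_congr_fun measurableSet_Ioi hGt,
      integral_integral_swap hint, integral_congr_ae hval, integral_const_mul, rieszForm]
  have h3 : ∫ t in Set.Ioi (0 : ℝ), t ^ (s - 1) * G t =
      energyConst d s * Real.Gamma s * (rieszForm d s g).re := by
    rw [← Complex.ofReal_re (∫ t in Set.Ioi (0 : ℝ), t ^ (s - 1) * G t), h2, Complex.re_ofReal_mul]
  rw [h1, ← ofReal_integral_eq_lintegral_ofReal hi2, h3, ← ENNReal.ofReal_inv_of_pos hG,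
    ← ENNReal.ofReal_mul (by positivity)]
  · congr 1
    field_simp
  · filter_upwards [ae_restrict_mem measurableSet_Ioi] with t ht
    have ht' : 0 < t := ht
    have := hG0 t
    positivity

/-! ### Duality of extremisers in Hilbert space. -/

theorem norm_sub_smul_sq {H : Type*} [NormedAddCommGroup H] [InnerProductSpace ℂ H]
    (x y : H) (C : ℝ) :
    ‖x - (C : ℂ) • y‖ ^ 2 = ‖x‖ ^ 2 - 2 * C * (inner ℂ x y).re + C ^ 2 * ‖y‖ ^ 2 := by
  rw [norm_sub_sq (𝕜 := ℂ), inner_smul_right, norm_smul]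
  simp only [RCLike.re_to_complex, Complex.re_ofReal_mul, Complex.norm_real, mul_pow,
    Real.norm_eq_abs, sq_abs]
  ring

section Hilbert

variable {H₁ H₂ : Type*} [NormedAddCommGroup H₁] [InnerProductSpace ℂ H₁] [CompleteSpace H₁]
  [NormedAddCommGroup H₂] [InnerProductSpace ℂ H₂] [CompleteSpace H₂]
  {E : H₁ →L[ℂ] H₂} {C : ℝ}

open ContinuousLinearMap

theorem norm_adjoint_apply_sq_le (hC : 0 ≤ C) (hE : ∀ g, ‖E g‖ ^ 2 ≤ C * ‖g‖ ^ 2) (h : H₂) :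
    ‖adjoint E h‖ ^ 2 ≤ C * ‖h‖ ^ 2 := by
  have h1 : ‖E‖ ≤ √C := E.opNorm_le_bound (Real.sqrt_nonneg _) fun g => by
    refine le_of_sq_le_sq ?_ (by positivity)
    rw [mul_pow, Real.sq_sqrt hC]
    exact hE g
  have h2 : ‖adjoint E h‖ ≤ √C * ‖h‖ := by
    refine (le_opNorm _ _).trans ?_
    rw [LinearIsometryEquiv.norm_map]
    gcongr
  calc ‖adjoint E h‖ ^ 2 ≤ (√C * ‖h‖) ^ 2 := by gcongr
    _ = _ := by rw [mul_pow, Real.sq_sqrt hC]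

/-- `‖E E* h - C h‖² = ‖E E* h‖² - 2C ‖E* h‖² + C² ‖h‖²`. The first term is at most `C ‖E* h‖²` and
the last equals it, so the sum is at most `0`. -/
theorem apply_adjoint_eq_of_norm_sq_eq (hC : 0 < C) (hE : ∀ g, ‖E g‖ ^ 2 ≤ C * ‖g‖ ^ 2) {h : H₂}
    (hh : ‖adjoint E h‖ ^ 2 = C * ‖h‖ ^ 2) :
    E (adjoint E h) = (C : ℂ) • h ∧ ‖E (adjoint E h)‖ ^ 2 = C * ‖adjoint E h‖ ^ 2 := by
  have h1 := norm_sub_smul_sq (E (adjoint E h)) h C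
  have h2 : (inner ℂ (E (adjoint E h)) h).re = ‖adjoint E h‖ ^ 2 := by
    rw [← adjoint_inner_right, inner_self_eq_norm_sq_to_K]
    norm_cast
  have h3 := hE (adjoint E h)
  have h4 : ‖E (adjoint E h) - (C : ℂ) • h‖ ^ 2 ≤ 0 := by
    rw [h1, h2]
    nlinarith
  have h5 : E (adjoint E h) = (C : ℂ) • h := by
    rw [← sub_eq_zero, ← norm_eq_zero]
    exact pow_eq_zero_iff two_ne_zero |>.1 (le_antisymm h4 (by positivity))
  refine ⟨h5, ?_⟩
  rw [h5, norm_smul, hh, mul_pow, Complex.norm_real, Real.norm_eq_abs, sq_abs]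
  ring

/-- The same completion of the square with `E` and its adjoint exchanged: `E` carries its
extremisers to those of the adjoint. -/
theorem norm_adjoint_apply_sq_eq (hC : 0 < C) (hE : ∀ g, ‖E g‖ ^ 2 ≤ C * ‖g‖ ^ 2) {u : H₁}
    (hu : ‖E u‖ ^ 2 = C * ‖u‖ ^ 2) : ‖adjoint E (E u)‖ ^ 2 = C * ‖E u‖ ^ 2 := by
  have h1 := norm_sub_smul_sq (adjoint E (E u)) u C
  have h2 : (inner ℂ (adjoint E (E u)) u).re = ‖E u‖ ^ 2 := by
    rw [adjoint_inner_left, inner_self_eq_norm_sq_to_K]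
    norm_cast
  have h3 := norm_adjoint_apply_sq_le hC.le hE (E u)
  have h4 : ‖adjoint E (E u) - (C : ℂ) • u‖ ^ 2 ≤ 0 := by
    rw [h1, h2]
    nlinarith
  have h5 : adjoint E (E u) = (C : ℂ) • u := by
    rw [← sub_eq_zero, ← norm_eq_zero]
    exact pow_eq_zero_iff two_ne_zero |>.1 (le_antisymm h4 (by positivity))
  rw [h5, norm_smul, hu, mul_pow, Complex.norm_real, Real.norm_eq_abs, sq_abs]
  ring

end Hilbert

/-! ### The weighted `L²` space and the extension operator. -/

/-- The measure `(2π)^{-d} |ξ|^{2s} dξ`. -/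
noncomputable def sobMeasure (d : ℕ) (s : ℝ) : Measure (Euc d) :=
  volume.withDensity fun ξ => ENNReal.ofReal (((2 * Real.pi) ^ d)⁻¹ * ‖ξ‖ ^ (2 * s))

theorem lintegral_sobMeasure (s : ℝ) (f : Euc d → ℝ≥0∞) :
    ∫⁻ ξ, f ξ ∂(sobMeasure d s) = ENNReal.ofReal (((2 * Real.pi) ^ d)⁻¹) *
      ∫⁻ ξ, ENNReal.ofReal (‖ξ‖ ^ (2 * s)) * f ξ := by
  rw [sobMeasure, lintegral_withDensity_eq_lintegral_mul_non_measurable _ (by fun_prop) (by simp),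
    ← lintegral_const_mul' _ _ ENNReal.ofReal_ne_top]
  refine lintegral_congr fun ξ => ?_
  rw [Pi.mul_apply, ENNReal.ofReal_mul (by positivity), mul_assoc]

theorem integral_sobMeasure (s : ℝ) (f : Euc d → ℂ) :
    ∫ ξ, f ξ ∂(sobMeasure d s) =
      ∫ ξ, ((((2 * Real.pi) ^ d)⁻¹ * ‖ξ‖ ^ (2 * s) : ℝ) : ℂ) * f ξ := by
  rw [sobMeasure, integral_withDensity_eq_integral_toReal_smul (by fun_prop) (by simp)]
  refine integral_congr_ae (.of_forall fun ξ => ?_)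
  simp only
  rw [ENNReal.toReal_ofReal (by positivity), Complex.real_smul]

theorem sobMeasure_absolutelyContinuous (s : ℝ) : sobMeasure d s ≪ volume :=
  withDensity_absolutelyContinuous _ _

theorem absolutelyContinuous_sobMeasure [NeZero d] (s : ℝ) : volume ≪ sobMeasure d s := by
  refine withDensity_absolutelyContinuous' (by fun_prop) ?_
  filter_upwards [Measure.ae_ne volume (0 : Euc d)] with ξ hξ
  have : 0 < ‖ξ‖ := norm_pos_iff.2 hξ
  have h : 0 < ((2 * Real.pi) ^ d)⁻¹ * ‖ξ‖ ^ (2 * s) := by positivity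
  simpa using h

/-- This puts Schwartz functions in `L²` of the weighted measure and, with finiteness on compacts,
makes them dense there. -/
theorem sobMeasure_hasTemperateGrowth {s : ℝ} (hs : 0 < s) :
    (sobMeasure d s).HasTemperateGrowth := by
  set n := d + 1 + ⌈2 * s⌉₊ with hn
  refine ⟨n, ?_⟩
  rw [sobMeasure, integrable_withDensity_iff_integrable_smul' (by fun_prop) (by simp)]
  have h1 := (integrable_one_add_norm (E := Euc d) (μ := volume) (r := d + 1)
    (by rw [finrank_euclideanSpace_fin]; linarith)).const_mul (((2 * Real.pi) ^ d)⁻¹)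
  refine h1.mono' (Measurable.aestronglyMeasurable (by fun_prop)) (.of_forall fun ξ => ?_)
  rw [ENNReal.toReal_ofReal (by positivity), smul_eq_mul, Real.norm_of_nonneg (by positivity),
    mul_assoc]
  gcongr
  have h2 : ‖ξ‖ ^ (2 * s) ≤ (1 + ‖ξ‖) ^ ((⌈2 * s⌉₊ : ℝ)) :=
    (Real.rpow_le_rpow (norm_nonneg _) (by linarith) (by positivity)).trans
      (Real.rpow_le_rpow_of_exponent_le (by linarith [norm_nonneg ξ]) (Nat.le_ceil _))
  calc _ ≤ (1 + ‖ξ‖) ^ ((⌈2 * s⌉₊ : ℝ)) * (1 + ‖ξ‖) ^ (-(n : ℝ)) := by gcongr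
    _ = _ := by
      rw [← Real.rpow_add (by positivity), hn]
      congr 1
      push_cast
      ring

theorem sobMeasure_isFiniteMeasureOnCompacts {s : ℝ} (hs : 0 < s) :
    IsFiniteMeasureOnCompacts (sobMeasure d s) := by
  refine ⟨fun K hK => ?_⟩
  rw [sobMeasure, withDensity_apply _ hK.measurableSet]
  have hc : Continuous fun ξ : Euc d => ((2 * Real.pi) ^ d)⁻¹ * ‖ξ‖ ^ (2 * s) :=
    continuous_const.mul (continuous_norm.rpow_const fun ξ => Or.inr (by positivity))
  exact (hc.continuousOn.integrableOn_compact hK).lintegral_lt_top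

theorem eLpNorm_two_sq {α E : Type*} [MeasurableSpace α] [NormedAddCommGroup E] (f : α → E)
    (μ : Measure α) : eLpNorm f 2 μ ^ 2 = ∫⁻ x, ‖f x‖ₑ ^ 2 ∂μ := by
  have := eLpNorm_nnreal_pow_eq_lintegral (f := f) (μ := μ) (p := 2) (by norm_num)
  simpa using this

theorem norm_toLp_two_sq {α E : Type*} [MeasurableSpace α] [NormedAddCommGroup E] {f : α → E}
    {μ : Measure α} (hf : MemLp f 2 μ) : ‖hf.toLp f‖ ^ 2 = (∫⁻ x, ‖f x‖ₑ ^ 2 ∂μ).toReal := by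
  rw [Lp.norm_toLp, ← eLpNorm_two_sq, ENNReal.toReal_pow]

theorem norm_Lp_two_sq {α E : Type*} [MeasurableSpace α] [NormedAddCommGroup E] {μ : Measure α}
    (g : Lp E 2 μ) : ‖g‖ ^ 2 = ∫ x, ‖g x‖ ^ 2 ∂μ := by
  rw [Lp.norm_def, ← ENNReal.toReal_pow, eLpNorm_two_sq,
    integral_eq_lintegral_of_nonneg_ae (f := fun x => ‖g x‖ ^ 2) (.of_forall fun x => by positivity)
      ((Lp.aestronglyMeasurable g).norm.pow 2)]
  congr 1
  refine lintegral_congr fun x => ?_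
  rw [ENNReal.ofReal_pow (norm_nonneg _), ofReal_norm]

/-- The function `|ξ|^{-2s} (g dσ)^(ξ)`. -/
noncomputable def extFun (s : ℝ) (g : Sph d → ℂ) (ξ : Euc d) : ℂ :=
  ((‖ξ‖ ^ (-(2 * s)) : ℝ) : ℂ) * sphFT g ξ

theorem energyConst_pos {s : ℝ} (hs : 1 / 2 < s) (hs' : s < (d : ℝ) / 2) : 0 < energyConst d s := by
  have := Real.Gamma_pos_of_pos (show 0 < s by linarith)
  have := Real.Gamma_pos_of_pos (show 0 < (d : ℝ) / 2 - s by linarith)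
  unfold energyConst
  positivity

theorem lintegral_extFun_sq (hd : 2 ≤ d) {s : ℝ} (hs : 1 / 2 < s) (hs' : s < (d : ℝ) / 2)
    {g : Sph d → ℂ} (hg : MemLp g 2 (surf d)) :
    ∫⁻ ξ, ‖extFun s g ξ‖ₑ ^ 2 ∂(sobMeasure d s) =
      ENNReal.ofReal (((2 * Real.pi) ^ d)⁻¹ * energyConst d s * (rieszForm d s g).re) := by
  have : NeZero d := ⟨by omega⟩
  rw [lintegral_sobMeasure, mul_assoc (((2 * Real.pi) ^ d)⁻¹), ENNReal.ofReal_mul (by positivity),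
    ← lintegral_sphFT_sq hd hs hs' hg]
  congr 1
  refine lintegral_congr_ae ?_
  filter_upwards [Measure.ae_ne volume (0 : Euc d)] with ξ hξ
  have hr : 0 < ‖ξ‖ := norm_pos_iff.2 hξ
  rw [extFun, enorm_mul, mul_pow, ← mul_assoc, ← ofReal_norm, Complex.norm_real,
    Real.norm_of_nonneg (by positivity), ← ENNReal.ofReal_pow (by positivity),
    ← ENNReal.ofReal_mul (by positivity), sq, ← mul_assoc, ← Real.rpow_add hr]
  simp

theorem aestronglyMeasurable_extFun (s : ℝ) {g : Sph d → ℂ} (hg : Integrable g (surf d)) :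
    AEStronglyMeasurable (extFun s g) (sobMeasure d s) :=
  (Measurable.aestronglyMeasurable (by fun_prop)).mul (continuous_sphFT hg).aestronglyMeasurable

theorem memLp_extFun (hd : 2 ≤ d) {s : ℝ} (hs : 1 / 2 < s) (hs' : s < (d : ℝ) / 2)
    {g : Sph d → ℂ} (hg : MemLp g 2 (surf d)) : MemLp (extFun s g) 2 (sobMeasure d s) := by
  refine ⟨aestronglyMeasurable_extFun s (hg.integrable (by norm_num)), ?_⟩
  have h := (eLpNorm_two_sq (extFun s g) (sobMeasure d s)).trans (lintegral_extFun_sq hd hs hs' hg)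
  have h2 : eLpNorm (extFun s g) 2 (sobMeasure d s) ^ 2 < ∞ := h ▸ ENNReal.ofReal_lt_top
  exact (ENNReal.pow_lt_top_iff.1 h2).resolve_right two_ne_zero

/-- Legendre duplication at `s - 1/2` trades `Γ(s - 1/2)` for `Γ(2s - 1)/Γ(s)`. -/
theorem traceConst_eq {s : ℝ} (hs : 1 / 2 < s) (hs' : s < (d : ℝ) / 2) :
    traceConst d s = ((2 * Real.pi) ^ d)⁻¹ * energyConst d s * rieszConst d s := by
  have h1 := Real.Gamma_mul_Gamma_add_half (s - 1 / 2)
  rw [sub_add_cancel, show 2 * (s - 1 / 2) = 2 * s - 1 by ring] at h1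
  have hG := Real.Gamma_pos_of_pos (show 0 < s by linarith)
  have hG2 := Real.Gamma_pos_of_pos (show 0 < (d : ℝ) / 2 + s - 1 by linarith)
  have h2 : Real.Gamma (s - 1 / 2) =
      Real.Gamma (2 * s - 1) * 2 ^ (1 - (2 * s - 1)) * √Real.pi / Real.Gamma s := by
    rw [← h1]; field_simp
  have e1 : (2 * Real.pi) ^ d = (2 : ℝ) ^ (d : ℝ) *
      (Real.pi ^ ((d : ℝ) / 2) * Real.pi ^ ((d : ℝ) / 2)) := by
    rw [mul_pow, ← Real.rpow_add Real.pi_pos, add_halves, Real.rpow_natCast, Real.rpow_natCast]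
  have e2 : Real.pi ^ (((d : ℝ) - 1) / 2) = Real.pi ^ ((d : ℝ) / 2) / √Real.pi := by
    rw [sub_div, Real.rpow_sub Real.pi_pos, Real.sqrt_eq_rpow]
  have e3 : (4 : ℝ) ^ ((d : ℝ) / 2 - s) = 2 ^ ((d : ℝ) - 2 * s) := by
    rw [show (4 : ℝ) = 2 ^ (2 : ℝ) by norm_num, ← Real.rpow_mul (by norm_num)]
    congr 1; ring
  have e4 : (2 : ℝ) ^ (1 - 2 * s) * 2 ^ (d : ℝ) = 2 ^ ((d : ℝ) - 2 * s) * 2 ^ (2 * s - 1) *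
      2 ^ (1 - (2 * s - 1)) := by
    rw [← Real.rpow_add two_pos, ← Real.rpow_add two_pos, ← Real.rpow_add two_pos]
    congr 1; ring
  have e5 : (2 : ℝ) ^ (1 - 2 * s) = 2 ^ ((d : ℝ) - 2 * s) * 2 ^ (2 * s - 1) *
      2 ^ (1 - (2 * s - 1)) / 2 ^ (d : ℝ) := by
    rw [← e4]; field_simp
  rw [traceConst, energyConst, rieszConst, h2, e1, e2, e3, e5,
    show (d : ℝ) / 2 - 1 + s = d / 2 + s - 1 by ring]
  generalize (2 : ℝ) ^ ((d : ℝ) - 2 * s) = A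
  generalize (2 : ℝ) ^ (2 * s - 1) = B
  generalize (2 : ℝ) ^ (1 - (2 * s - 1)) = D
  have hp : 0 < Real.pi ^ ((d : ℝ) / 2) := Real.rpow_pos_of_pos Real.pi_pos _
  have hq : 0 < √Real.pi := Real.sqrt_pos.2 Real.pi_pos
  have hr : (0 : ℝ) < 2 ^ (d : ℝ) := by positivity
  field_simp

theorem traceConst_pos {s : ℝ} (hs : 1 / 2 < s) (hs' : s < (d : ℝ) / 2) : 0 < traceConst d s := by
  rw [traceConst_eq hs hs']
  have := energyConst_pos hs hs'
  have := rieszConst_pos hs hs'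
  positivity

theorem sphFT_congr {g h : Sph d → ℂ} (hgh : g =ᵐ[surf d] h) : sphFT g = sphFT h := by
  ext ξ
  refine integral_congr_ae ?_
  filter_upwards [hgh] with ω hω
  rw [hω]

theorem extFun_congr (s : ℝ) {g h : Sph d → ℂ} (hgh : g =ᵐ[surf d] h) :
    extFun s g = extFun s h := by
  ext ξ
  rw [extFun, extFun, sphFT_congr hgh]

theorem extFun_add (s : ℝ) {g h : Sph d → ℂ} (hg : Integrable g (surf d))
    (hh : Integrable h (surf d)) : extFun s (g + h) = extFun s g + extFun s h := by
  ext ξ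
  simp only [extFun, sphFT, Pi.add_apply, mul_add]
  rw [integral_add (integrable_exp_mul hg ξ) (integrable_exp_mul hh ξ), mul_add]

theorem extFun_smul (s : ℝ) (c : ℂ) (g : Sph d → ℂ) :
    extFun s (c • g) = c • extFun s g := by
  ext ξ
  simp only [extFun, sphFT, Pi.smul_apply, smul_eq_mul]
  simp_rw [mul_left_comm _ c]
  rw [integral_const_mul]
  ring

theorem Lp_integrable (g : Lp ℂ 2 (surf d)) : Integrable g (surf d) :=
  (Lp.memLp g).integrable (by norm_num)

/-- The map `g ↦ |ξ|^{-2s} (g dσ)^`, the adjoint of the restriction operator. -/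
noncomputable def extOp (hd : 2 ≤ d) {s : ℝ} (hs : 1 / 2 < s) (hs' : s < (d : ℝ) / 2) :
    Lp ℂ 2 (surf d) →ₗ[ℂ] Lp ℂ 2 (sobMeasure d s) where
  toFun g := (memLp_extFun hd hs hs' (Lp.memLp g)).toLp _
  map_add' g h := by
    rw [← MemLp.toLp_add]
    refine MemLp.toLp_congr _ _ ?_
    rw [← extFun_add s (Lp_integrable g) (Lp_integrable h), extFun_congr s (Lp.coeFn_add g h)]
  map_smul' c g := by
    rw [RingHom.id_apply, ← MemLp.toLp_const_smul]
    refine MemLp.toLp_congr _ _ ?_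
    rw [← extFun_smul, extFun_congr s (Lp.coeFn_smul c g)]

/-- The maximum with `0` comes from truncation in `ENNReal.ofReal`; it spares a separate proof that
the form is nonnegative. -/
theorem norm_extOp_sq (hd : 2 ≤ d) {s : ℝ} (hs : 1 / 2 < s) (hs' : s < (d : ℝ) / 2)
    (g : Lp ℂ 2 (surf d)) : ‖extOp hd hs hs' g‖ ^ 2 =
      max (((2 * Real.pi) ^ d)⁻¹ * energyConst d s * (rieszForm d s g).re) 0 := by
  change ‖(memLp_extFun hd hs hs' (Lp.memLp g)).toLp _‖ ^ 2 = _
  rw [norm_toLp_two_sq, lintegral_extFun_sq hd hs hs' (Lp.memLp g), ENNReal.toReal_ofReal']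

theorem norm_extOp_sq_le (hd : 2 ≤ d) {s : ℝ} (hs : 1 / 2 < s) (hs' : s < (d : ℝ) / 2)
    (g : Lp ℂ 2 (surf d)) : ‖extOp hd hs hs' g‖ ^ 2 ≤ traceConst d s * ‖g‖ ^ 2 := by
  have h1 := rieszForm_re_le hd hs hs' (Lp.memLp g)
  have h2 := energyConst_pos hs hs'
  have h3 := traceConst_pos hs hs'
  rw [norm_extOp_sq, norm_Lp_two_sq]
  refine max_le ?_ (mul_nonneg h3.le (integral_nonneg fun ω => by positivity))
  rw [traceConst_eq hs hs', mul_assoc _ (rieszConst d s)]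
  gcongr

theorem norm_extOp_sq_eq_iff (hd : 2 ≤ d) {s : ℝ} (hs : 1 / 2 < s) (hs' : s < (d : ℝ) / 2)
    (g : Lp ℂ 2 (surf d)) : ‖extOp hd hs hs' g‖ ^ 2 = traceConst d s * ‖g‖ ^ 2 ↔
      ∃ c : ℂ, g =ᵐ[surf d] fun _ => c := by
  have h2 := energyConst_pos hs hs'
  have h3 := rieszConst_pos hs hs'
  have hk : 0 < ((2 * Real.pi) ^ d)⁻¹ * energyConst d s := by positivity
  have h4 : 0 ≤ ∫ ω, ‖g ω‖ ^ 2 ∂(surf d) := integral_nonneg fun ω => by positivity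
  rw [norm_extOp_sq, norm_Lp_two_sq, traceConst_eq hs hs', mul_assoc _ (rieszConst d s)]
  constructor
  · intro h
    rcases eq_or_lt_of_le h4 with h0 | h0
    · have : ‖g‖ ^ 2 = 0 := by rw [norm_Lp_two_sq, h0]
      have hg : g = 0 := by simpa using this
      exact ⟨0, by rw [hg]; exact Lp.coeFn_zero _ _ _⟩
    · have hpos : 0 < ((2 * Real.pi) ^ d)⁻¹ * energyConst d s *
        (rieszConst d s * ∫ ω, ‖g ω‖ ^ 2 ∂(surf d)) := by positivity
      -- The other side is positive, so the maximum cannot be attained by its second argument `0`.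
      rw [max_eq_left_of_lt (by by_contra hc; rw [max_eq_right (not_lt.1 hc)] at h; linarith)] at h
      exact ae_eq_const_of_rieszForm_eq hd hs hs' (Lp.memLp g) (mul_left_cancel₀ hk.ne' h)
  · rintro ⟨c, hc⟩
    have e1 : rieszForm d s g = rieszForm d s fun _ => c := by
      refine integral_congr_ae ?_
      filter_upwards [Measure.quasiMeasurePreserving_fst.ae hc,
        Measure.quasiMeasurePreserving_snd.ae hc] with p hp1 hp2
      rw [hp1, hp2]
    have e2 : ∫ ω, ‖g ω‖ ^ 2 ∂(surf d) = ∫ _, ‖c‖ ^ 2 ∂(surf d) :=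
      integral_congr_ae (hc.mono fun ω hω => by simp only [hω])
    rw [e1, rieszForm_const hd hs hs', ← e2, max_eq_left (by positivity)]

/-- `extOp` as a bounded operator. -/
noncomputable def extCLM (hd : 2 ≤ d) {s : ℝ} (hs : 1 / 2 < s) (hs' : s < (d : ℝ) / 2) :
    Lp ℂ 2 (surf d) →L[ℂ] Lp ℂ 2 (sobMeasure d s) :=
  (extOp hd hs hs').mkContinuous √(traceConst d s) fun g => by
    refine le_of_sq_le_sq ?_ (by positivity)
    rw [mul_pow, Real.sq_sqrt (traceConst_pos hs hs').le]
    exact norm_extOp_sq_le hd hs hs' g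

theorem extCLM_coeFn (hd : 2 ≤ d) {s : ℝ} (hs : 1 / 2 < s) (hs' : s < (d : ℝ) / 2)
    (g : Lp ℂ 2 (surf d)) : extCLM hd hs hs' g =ᵐ[sobMeasure d s] extFun s g :=
  (memLp_extFun hd hs hs' (Lp.memLp g)).coeFn_toLp

/-! ### Fourier transform of tempered distributions and their representing functions. -/

theorem schwartzHat_apply_eq_fourier (φ : 𝓢(Euc d, ℂ)) (ξ : Euc d) :
    schwartzHat d φ ξ = (𝓕 φ) (((2 * Real.pi)⁻¹ : ℝ) • ξ) := rfl

/-- Fourier inversion in the normalisation of `schwartzHat`. -/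
theorem integral_exp_mul_schwartzHat (φ : 𝓢(Euc d, ℂ)) (x : Euc d) :
    ∫ ξ, Complex.exp (Complex.I * (inner ℝ x ξ : ℝ)) * schwartzHat d φ ξ =
      (((2 * Real.pi) ^ d : ℝ) : ℂ) * φ x := by
  have h1 : φ x = (𝓕⁻ (𝓕 φ)) x := by rw [FourierTransform.fourierInv_fourier_eq]
  rw [SchwartzMap.fourierInv_coe, Real.fourierInv_eq'] at h1
  have h2 := Measure.integral_comp_inv_smul_of_nonneg (volume : Measure (Euc d))
    (fun v => Complex.exp (((2 * Real.pi * inner ℝ v x : ℝ) : ℂ) * Complex.I) • (𝓕 φ) v)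
    (R := 2 * Real.pi) (by positivity)
  rw [← h1, finrank_euclideanSpace_fin, Complex.real_smul] at h2
  rw [← h2]
  refine integral_congr_ae (.of_forall fun ξ => ?_)
  simp only [schwartzHat_apply_eq_fourier, smul_eq_mul]
  congr 2
  rw [real_inner_smul_left, real_inner_comm, ← mul_assoc, mul_inv_cancel₀ (by positivity), one_mul,
    mul_comm]

theorem schwartzHat_surjective : Function.Surjective (schwartzHat d) := fun ψ => by
  refine ⟨𝓕⁻ (SchwartzMap.compCLMOfContinuousLinearEquiv ℂ (dil d).symm ψ), ?_⟩
  ext ξ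
  rw [schwartzHat_apply_eq_fourier, FourierTransform.fourier_fourierInv_eq]
  change ψ ((dil d).symm (dil d ξ)) = ψ ξ
  rw [ContinuousLinearEquiv.symm_apply_apply]

theorem hat_injective : Function.Injective (hat (d := d)) := fun f g h => by
  ext φ
  obtain ⟨ψ, rfl⟩ := schwartzHat_surjective φ
  rw [← hat_apply, h, hat_apply]

theorem hat_ne_zero_iff {f : 𝓢'(Euc d, ℂ)} : hat f ≠ 0 ↔ f ≠ 0 :=
  hat_injective.ne_iff (y := 0)

theorem hat_sub (f g : 𝓢'(Euc d, ℂ)) : hat (f - g) = hat f - hat g := rfl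

theorem integrable_phase_mul {α β : Type*} [MeasurableSpace α] [MeasurableSpace β]
    {μ : Measure α} {ν : Measure β} [SFinite ν] {f : α → ℂ} {g : β → ℂ} (hf : Integrable f μ)
    (hg : Integrable g ν) {p : α × β → ℝ} (hp : Measurable p) :
    Integrable (fun q : α × β => Complex.exp (-Complex.I * (p q : ℝ)) * (f q.1 * g q.2))
      (μ.prod ν) := by
  refine (hf.mul_prod hg).norm.mono'
    ((Measurable.aestronglyMeasurable (by fun_prop)).mul (hf.mul_prod hg).1)
    (.of_forall fun q => ?_)
  rw [norm_mul, norm_exp_neg_I_mul, one_mul]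

theorem integral_schwartzHat_mul (φ ψ : 𝓢(Euc d, ℂ)) :
    ∫ x, schwartzHat d φ x * ψ x = ∫ x, φ x * schwartzHat d ψ x := by
  simp_rw [schwartzHat_apply, ← integral_mul_const, ← integral_const_mul]
  rw [integral_integral_swap]
  · refine integral_congr_ae (.of_forall fun x => integral_congr_ae (.of_forall fun y => ?_))
    simp only
    rw [real_inner_comm]
    ring
  · refine (integrable_phase_mul (ψ.integrable (μ := volume)) (φ.integrable (μ := volume))
      (p := fun q => inner ℝ q.2 q.1) (by fun_prop)).congr (.of_forall fun q => ?_)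
    simp only [Function.uncurry]
    ring

theorem represents_hat_schwartz (φ : 𝓢(Euc d, ℂ)) :
    Represents (schwartzHat d φ) (hat (φ : 𝓢'(Euc d, ℂ))) := fun ψ => by
  constructor
  · exact (SchwartzMap.pairing (ContinuousLinearMap.mul ℂ ℂ) (schwartzHat d φ) ψ).integrable
      (μ := volume)
  · rw [hat_apply, SchwartzMap.coe_apply, integral_schwartzHat_mul]
    refine integral_congr_ae (.of_forall fun x => ?_)
    simp [mul_comm]

theorem Represents.sub {u v : Euc d → ℂ} {S T : 𝓢'(Euc d, ℂ)} (hu : Represents u S)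
    (hv : Represents v T) : Represents (u - v) (S - T) := fun φ => by
  have h1 := hu φ
  have h2 := hv φ
  simp only [Pi.sub_apply, sub_mul]
  refine ⟨h1.1.sub h2.1, ?_⟩
  rw [integral_sub h1.1 h2.1, ← h1.2, ← h2.2]
  rfl

theorem Represents.congr {u v : Euc d → ℂ} {T : 𝓢'(Euc d, ℂ)} (hu : Represents u T)
    (h : u =ᵐ[volume] v) : Represents v T := fun φ => by
  have h1 : (fun x => u x * φ x) =ᵐ[volume] fun x => v x * φ x := h.mono fun x hx => by
    simp only [hx]
  exact ⟨(hu φ).1.congr h1, (hu φ).2.trans (integral_congr_ae h1)⟩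

theorem Represents.locallyIntegrable {u : Euc d → ℂ} {T : 𝓢'(Euc d, ℂ)} (hu : Represents u T) :
    LocallyIntegrable u := by
  rw [locallyIntegrable_iff]
  intro K hK
  obtain ⟨R, hR, hKR⟩ := hK.isBounded.subset_closedBall_lt 0 (0 : Euc d)
  let b : ContDiffBump (0 : Euc d) := ⟨R, R + 1, hR, by linarith⟩
  have hg₁ : HasCompactSupport (Complex.ofRealCLM ∘ b) := b.hasCompactSupport.comp_left rfl
  have hg₂ : ContDiff ℝ (⊤ : ℕ∞) (Complex.ofRealCLM ∘ b) :=
    Complex.ofRealCLM.contDiff.comp b.contDiff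
  -- Testing against a bump function equal to `1` on `K` gives integrability of `u` on `K`.
  have h := (hu (hg₁.toSchwartzMap hg₂)).1.integrableOn (s := K)
  refine h.congr_fun (fun x hx => ?_) hK.measurableSet
  have : b x = 1 := b.one_of_mem_closedBall (hKR hx)
  simp [this]

theorem Represents.ae_eq {u v : Euc d → ℂ} {T : 𝓢'(Euc d, ℂ)} (hu : Represents u T)
    (hv : Represents v T) : u =ᵐ[volume] v := by
  refine ae_eq_of_integral_contDiff_smul_eq hu.locallyIntegrable hv.locallyIntegrable
    fun g g_smooth g_cpt => ?_
  have hg₁ : HasCompactSupport (Complex.ofRealCLM ∘ g) := g_cpt.comp_left rfl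
  have hg₂ : ContDiff ℝ (⊤ : ℕ∞) (Complex.ofRealCLM ∘ g) := by fun_prop
  have h1 := (hu (hg₁.toSchwartzMap hg₂)).2
  rw [(hv (hg₁.toSchwartzMap hg₂)).2] at h1
  simpa [mul_comm] using h1.symm

/-- Representatives agree almost everywhere by `Represents.ae_eq`, so the infimum runs over a single
value. -/
theorem sobolevENorm_eq_eLpNorm {s : ℝ} {f : 𝓢'(Euc d, ℂ)} {h : Euc d → ℂ}
    (hh : Represents h (hat f)) : sobolevENorm s f = eLpNorm h 2 (sobMeasure d s) := by
  have key : ∀ u : Euc d → ℂ, (ENNReal.ofReal (((2 * Real.pi) ^ d)⁻¹) *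
      ∫⁻ ξ, ENNReal.ofReal (‖ξ‖ ^ (2 * s)) * ‖u ξ‖ₑ ^ 2) ^ (1 / 2 : ℝ) =
        eLpNorm u 2 (sobMeasure d s) := fun u => by
    rw [← lintegral_sobMeasure, ← eLpNorm_two_sq, ← ENNReal.rpow_natCast, ← ENNReal.rpow_mul]
    norm_num
  unfold sobolevENorm
  simp_rw [key]
  refine le_antisymm (iInf₂_le h hh) (le_iInf₂ fun u hu => ?_)
  exact (eLpNorm_congr_ae ((sobMeasure_absolutelyContinuous s).ae_eq (hh.ae_eq hu))).le

theorem memSobolevHom_iff [NeZero d] {s : ℝ} {f : 𝓢'(Euc d, ℂ)} :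
    MemSobolevHom s f ↔ ∃ h, Represents h (hat f) ∧ MemLp h 2 (sobMeasure d s) := by
  constructor
  · intro hf
    -- An infimum over no representatives is `∞`, so a finite norm provides one.
    have h0 : ∃ h, Represents h (hat f) := by
      by_contra! hc
      rw [MemSobolevHom, sobolevENorm, iInf₂_eq_top.2 fun h hh => absurd hh (hc h)] at hf
      exact lt_irrefl _ hf
    obtain ⟨h, hh⟩ := h0
    refine ⟨h, hh, hh.locallyIntegrable.aestronglyMeasurable.mono_ac
      (sobMeasure_absolutelyContinuous s), ?_⟩
    rw [← sobolevENorm_eq_eLpNorm hh]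
    exact hf
  · rintro ⟨h, hh, hm⟩
    rw [MemSobolevHom, sobolevENorm_eq_eLpNorm hh]
    exact hm.2

/-! ### The trace as the adjoint of the extension operator. -/

theorem memLp_schwartz_sphere (φ : 𝓢(Euc d, ℂ)) :
    MemLp (fun ω : Sph d => φ (ω : Euc d)) 2 (surf d) := by
  have hc : Continuous fun ω : Sph d => φ (ω : Euc d) := φ.continuous.comp continuous_subtype_val
  exact MemLp.of_bound hc.aestronglyMeasurable (SchwartzMap.seminorm ℝ 0 0 φ)
    (.of_forall fun ω => SchwartzMap.norm_le_seminorm ℝ φ _)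

theorem memLp_schwartz_sobMeasure {s : ℝ} (hs : 0 < s) (φ : 𝓢(Euc d, ℂ)) :
    MemLp φ 2 (sobMeasure d s) :=
  have := sobMeasure_hasTemperateGrowth (d := d) hs
  φ.memLp 2 _

open ContinuousLinearMap in
/-- The adjoint of `extCLM` restricts Schwartz functions to the sphere. -/
theorem adjoint_extCLM_schwartzHat (hd : 2 ≤ d) {s : ℝ} (hs : 1 / 2 < s) (hs' : s < (d : ℝ) / 2)
    (φ : 𝓢(Euc d, ℂ)) :
    adjoint (extCLM hd hs hs')
      ((memLp_schwartz_sobMeasure (by linarith : 0 < s) (schwartzHat d φ)).toLp _) =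
      (memLp_schwartz_sphere φ).toLp _ := by
  have : NeZero d := ⟨by omega⟩
  refine ext_inner_left ℂ fun g => ?_
  rw [adjoint_inner_right, L2.inner_def, L2.inner_def]
  have hgi := Lp_integrable g
  have e1 : ∫ ξ, inner ℂ (extCLM hd hs hs' g ξ)
      (((memLp_schwartz_sobMeasure (by linarith : 0 < s) (schwartzHat d φ)).toLp _ :
        Lp ℂ 2 (sobMeasure d s)) ξ) ∂(sobMeasure d s) =
      ∫ ξ, schwartzHat d φ ξ * star (extFun s g ξ) ∂(sobMeasure d s) := by
    refine integral_congr_ae ?_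
    filter_upwards [extCLM_coeFn hd hs hs' g,
      (memLp_schwartz_sobMeasure (by linarith : 0 < s) (schwartzHat d φ)).coeFn_toLp] with ξ h1 h2
    rw [h1, h2, RCLike.inner_apply]
    rfl
  have e2 : ∫ ω, inner ℂ (g ω) (((memLp_schwartz_sphere φ).toLp _ : Lp ℂ 2 (surf d)) ω) ∂(surf d) =
      ∫ ω : Sph d, φ (ω : Euc d) * star (g ω) ∂(surf d) := by
    refine integral_congr_ae ?_
    filter_upwards [(memLp_schwartz_sphere φ).coeFn_toLp] with ω h1
    rw [h1, RCLike.inner_apply]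
    rfl
  rw [e1, e2, integral_sobMeasure]
  -- Away from `0` the weight `|ξ|^{2s}` cancels the `|ξ|^{-2s}` of the extension. After Fubini,
  -- Fourier inversion at `ω` produces `φ(ω)`.
  have e3 : ∀ᵐ ξ : Euc d, ((((2 * Real.pi) ^ d)⁻¹ * ‖ξ‖ ^ (2 * s) : ℝ) : ℂ) *
      (schwartzHat d φ ξ * star (extFun s g ξ)) = ((((2 * Real.pi) ^ d)⁻¹ : ℝ) : ℂ) *
        ∫ ω : Sph d, Complex.exp (Complex.I * (inner ℝ (ω : Euc d) ξ : ℝ)) *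
          (schwartzHat d φ ξ * star (g ω)) ∂(surf d) := by
    filter_upwards [Measure.ae_ne volume (0 : Euc d)] with ξ hξ
    have hr : 0 < ‖ξ‖ := norm_pos_iff.2 hξ
    have h1 : star (sphFT g ξ) = ∫ ω : Sph d,
        star (Complex.exp (-Complex.I * (inner ℝ (ω : Euc d) ξ : ℝ)) * g ω) ∂(surf d) :=
      integral_conj.symm
    have h2 : ‖ξ‖ ^ (2 * s) * ‖ξ‖ ^ (-(2 * s)) = 1 := by
      rw [← Real.rpow_add hr]; simp
    have h3 : ∫ ω : Sph d, Complex.exp (Complex.I * (inner ℝ (ω : Euc d) ξ : ℝ)) *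
          (schwartzHat d φ ξ * star (g ω)) ∂(surf d) = schwartzHat d φ ξ * star (sphFT g ξ) := by
      rw [h1, ← integral_const_mul]
      refine integral_congr_ae (.of_forall fun ω => ?_)
      simp only [star_mul', star_exp_neg_I_mul]
      ring
    have h4 : star (extFun s g ξ) = ((‖ξ‖ ^ (-(2 * s)) : ℝ) : ℂ) * star (sphFT g ξ) := by
      rw [extFun, star_mul']
      simp
    rw [h3, h4, Complex.ofReal_mul]
    calc _ = ((((2 * Real.pi) ^ d)⁻¹ : ℝ) : ℂ) *
        ((‖ξ‖ ^ (2 * s) * ‖ξ‖ ^ (-(2 * s)) : ℝ) : ℂ) * (schwartzHat d φ ξ * star (sphFT g ξ)) := by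
          push_cast; ring
      _ = _ := by rw [h2]; push_cast; ring
  have hstar : Integrable (fun ω => star (g ω)) (surf d) :=
    hgi.norm.mono' (continuous_star.comp_aestronglyMeasurable hgi.1)
      (.of_forall fun _ => (norm_star _).le)
  rw [integral_congr_ae e3, integral_const_mul, integral_integral_swap]
  · rw [← integral_const_mul]
    refine integral_congr_ae (.of_forall fun ω => ?_)
    simp only
    simp_rw [← mul_assoc]
    rw [integral_mul_const, integral_exp_mul_schwartzHat, ← mul_assoc, ← mul_assoc,
      ← Complex.ofReal_mul, inv_mul_cancel₀ (by positivity)]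
    simp
  · refine (integrable_phase_mul ((schwartzHat d φ).integrable (μ := volume)) hstar
      (p := fun q : Euc d × Sph d => -inner ℝ (q.2 : Euc d) q.1)
        (by fun_prop)).congr (.of_forall fun q => ?_)
    simp [Function.uncurry]

-- The two limits defining a trace are limits in `L²` of the weighted measure and of the sphere. The
-- adjoint is continuous and restricts Schwartz functions pointwise, which gives uniqueness; density
-- of Schwartz functions gives existence.
open ContinuousLinearMap in
theorem isTrace_iff (hd : 2 ≤ d) {s : ℝ} (hs : 1 / 2 < s) (hs' : s < (d : ℝ) / 2)
    {f : 𝓢'(Euc d, ℂ)} {h : Euc d → ℂ} (hh : Represents h (hat f))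
    (hm : MemLp h 2 (sobMeasure d s)) (G : Lp ℂ 2 (surf d)) :
    IsTrace s f G ↔ G = adjoint (extCLM hd hs hs') (hm.toLp h) := by
  have hs0 : 0 < s := by linarith
  have htg := sobMeasure_hasTemperateGrowth (d := d) hs0
  have hfc := sobMeasure_isFiniteMeasureOnCompacts (d := d) hs0
  have e1 : ∀ φ : 𝓢(Euc d, ℂ), sobolevENorm s ((φ : 𝓢'(Euc d, ℂ)) - f) =
      edist ((memLp_schwartz_sobMeasure hs0 (schwartzHat d φ)).toLp _) (hm.toLp h) := fun φ => by
    rw [sobolevENorm_eq_eLpNorm (hat_sub _ f ▸ (represents_hat_schwartz φ).sub hh),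
      Lp.edist_toLp_toLp]
  have e2 : ∀ φ : 𝓢(Euc d, ℂ), eLpNorm (fun ω : Sph d => φ (ω : Euc d) - G ω) 2 (surf d) =
      edist ((memLp_schwartz_sphere φ).toLp _) G := fun φ => by
    rw [Lp.edist_def]
    refine eLpNorm_congr_ae ?_
    filter_upwards [(memLp_schwartz_sphere φ).coeFn_toLp] with ω h1
    rw [Pi.sub_apply, h1]
  unfold IsTrace
  simp_rw [e1, e2, ← tendsto_iff_edist_tendsto_0]
  constructor
  · rintro ⟨φ, h1, h2⟩
    have h3 := ((adjoint (extCLM hd hs hs')).continuous.tendsto _).comp h1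
    refine tendsto_nhds_unique h2 (h3.congr fun n => ?_)
    exact adjoint_extCLM_schwartzHat hd hs hs' (φ n)
  · rintro rfl
    have hdense := SchwartzMap.denseRange_toLpCLM (F := ℂ) (p := 2) (by norm_num)
      (μ := sobMeasure d s) (hm.toLp h)
    obtain ⟨x, hx, hlim⟩ := mem_closure_iff_seq_limit.1 hdense
    choose ψ hψ using hx
    choose φ hφ using fun n => schwartzHat_surjective (ψ n)
    have h1 : Tendsto (fun n =>
        (memLp_schwartz_sobMeasure hs0 (schwartzHat d (φ n))).toLp _) atTop (𝓝 (hm.toLp h)) := by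
      refine hlim.congr fun n => ?_
      rw [← hψ n, ← hφ n]
      rfl
    refine ⟨φ, h1, ?_⟩
    refine (((adjoint (extCLM hd hs hs')).continuous.tendsto _).comp h1).congr fun n => ?_
    exact adjoint_extCLM_schwartzHat hd hs hs' (φ n)

/-! ### The Fourier transform of the Riesz kernel and of its convolution with `dσ`. -/

theorem integrableOn_norm_rpow_ball [NeZero d] {b : ℝ} (hb : b < d) :
    IntegrableOn (fun x : Euc d => ‖x‖ ^ (-b)) (Metric.ball 0 1) := by
  have hd : 1 ≤ d := NeZero.one_le
  rw [integrableOn_fun_norm_addHaar volume (f := fun r : ℝ => r ^ (-b)), finrank_euclideanSpace_fin]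
  have h := (intervalIntegral.integrableOn_Ioo_rpow_iff (s := (d : ℝ) - 1 - b) one_pos).2
    (by linarith)
  refine h.congr_fun (fun r hr => ?_) measurableSet_Ioo
  simp only [smul_eq_mul]
  rw [← Real.rpow_natCast, ← Real.rpow_add hr.1, Nat.cast_sub hd]
  push_cast
  rfl

/-- Inside the unit ball around `w` bound `ψ` by its supremum, outside bound the kernel by `1`. The
bound is uniform in `w`, as integration of `w` over the sphere requires. -/
theorem exists_integrable_norm_rpow_mul_schwartz [NeZero d] {b : ℝ} (hb0 : 0 ≤ b) (hb : b < d)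
    (ψ : 𝓢(Euc d, ℂ)) : ∃ C : ℝ, ∀ w : Euc d,
      Integrable (fun x => ((‖x - w‖ ^ (-b) : ℝ) : ℂ) * ψ x) ∧
      ∫ x, ‖((‖x - w‖ ^ (-b) : ℝ) : ℂ) * ψ x‖ ≤ C := by
  set M := SchwartzMap.seminorm ℝ 0 0 ψ with hM
  have hM0 : 0 ≤ M := apply_nonneg _ _
  set k : Euc d → ℝ := (Metric.ball 0 1).indicator fun x => ‖x‖ ^ (-b) with hk
  have hki : Integrable k := (integrable_indicator_iff measurableSet_ball).2
    (integrableOn_norm_rpow_ball hb)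
  have hψ := (ψ.integrable (μ := volume)).norm
  have hbound : ∀ w x : Euc d, ‖((‖x - w‖ ^ (-b) : ℝ) : ℂ) * ψ x‖ ≤ k (x - w) * M + ‖ψ x‖ := by
    intro w x
    rw [norm_mul, Complex.norm_real, Real.norm_of_nonneg (by positivity)]
    by_cases hx : x - w ∈ Metric.ball (0 : Euc d) 1
    · rw [hk, Set.indicator_of_mem hx]
      have := SchwartzMap.norm_le_seminorm ℝ ψ x
      have h2 : ‖x - w‖ ^ (-b) * ‖ψ x‖ ≤ ‖x - w‖ ^ (-b) * M := by gcongr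
      linarith [norm_nonneg (ψ x)]
    · rw [hk, Set.indicator_of_notMem hx, zero_mul, zero_add]
      refine mul_le_of_le_one_left (norm_nonneg _) ?_
      exact Real.rpow_le_one_of_one_le_of_nonpos (by simpa using hx) (by linarith)
  have hi : ∀ w : Euc d, Integrable fun x => k (x - w) * M + ‖ψ x‖ := fun w =>
    ((hki.comp_sub_right w).mul_const M).add hψ
  refine ⟨(∫ x, k x) * M + ∫ x, ‖ψ x‖, fun w => ?_⟩
  have h1 : Integrable (fun x => ((‖x - w‖ ^ (-b) : ℝ) : ℂ) * ψ x) :=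
    (hi w).mono' ((Measurable.aestronglyMeasurable (by fun_prop)).mul
      ψ.continuous.aestronglyMeasurable) (.of_forall (hbound w))
  refine ⟨h1, (integral_mono h1.norm (hi w) (hbound w)).trans_eq ?_⟩
  rw [integral_add ((hki.comp_sub_right w).mul_const M) hψ, integral_mul_const,
    integral_sub_right_eq_self]

/-- Fubini for a superposition `K x = ∫ k (t, x) dt` of nonnegative kernels. -/
theorem integral_superposition {X : Type*} [MeasurableSpace X] {ν : Measure X} [SFinite ν]
    {k : ℝ × X → ℝ} (hk : Measurable k) (hk0 : ∀ t : ℝ, 0 < t → ∀ x, 0 ≤ k (t, x)) {K : X → ℝ}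
    {Φ : X → ℂ} (hΦ : AEStronglyMeasurable Φ ν)
    (h1 : ∀ᵐ x ∂ν, IntegrableOn (fun t => k (t, x)) (Set.Ioi 0) ∧
      ∫ t in Set.Ioi (0 : ℝ), k (t, x) = K x)
    (h2 : Integrable (fun x => (K x : ℂ) * Φ x) ν) :
    ∫ x, (K x : ℂ) * Φ x ∂ν = ∫ t in Set.Ioi (0 : ℝ), ∫ x, (k (t, x) : ℂ) * Φ x ∂ν := by
  have hint : Integrable (fun q : ℝ × X => (k q : ℂ) * Φ q.2)
      ((volume.restrict (Set.Ioi 0)).prod ν) := by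
    have hm : AEStronglyMeasurable (fun q : ℝ × X => (k q : ℂ) * Φ q.2)
        ((volume.restrict (Set.Ioi 0)).prod ν) :=
      (Measurable.aestronglyMeasurable (by fun_prop)).mul hΦ.comp_snd
    rw [integrable_prod_iff' hm]
    constructor
    · filter_upwards [h1] with x hx
      exact (hx.1.ofReal (𝕜 := ℂ)).mul_const _
    · refine h2.norm.congr ?_
      filter_upwards [h1] with x hx
      simp only [norm_mul, Complex.norm_real]
      rw [integral_mul_const, ← hx.2]
      congr 1
      rw [Real.norm_of_nonneg (setIntegral_nonneg measurableSet_Ioi fun t ht => hk0 t ht x)]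
      refine setIntegral_congr_fun measurableSet_Ioi fun t ht => ?_
      exact (Real.norm_of_nonneg (hk0 t ht x)).symm
  rw [integral_integral_swap hint]
  refine integral_congr_ae ?_
  filter_upwards [h1] with x hx
  rw [integral_mul_const, integral_complex_ofReal, hx.2]

theorem integral_gaussian_mul_schwartzHat (φ : 𝓢(Euc d, ℂ)) (w : Euc d) {t : ℝ} (ht : 0 < t) :
    ∫ x, ((Real.exp (-(t * ‖x - w‖ ^ 2)) : ℝ) : ℂ) * schwartzHat d φ x =
      ∫ ξ, (((Real.pi / t) ^ ((d : ℝ) / 2) * Real.exp (-(‖ξ‖ ^ 2 / (4 * t))) : ℝ) : ℂ) *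
        (Complex.exp (-Complex.I * (inner ℝ w ξ : ℝ)) * φ ξ) := by
  simp_rw [schwartzHat_apply, ← integral_const_mul]
  have hg : Integrable fun x : Euc d => ((Real.exp (-(t * ‖x - w‖ ^ 2)) : ℝ) : ℂ) :=
    ((integrable_gaussian ht).comp_sub_right w).ofReal
  rw [integral_integral_swap]
  · refine integral_congr_ae (.of_forall fun ξ => ?_)
    simp only
    have h1 := integral_add_right_eq_self (μ := (volume : Measure (Euc d)))
      (fun x => ((Real.exp (-(t * ‖x - w‖ ^ 2)) : ℝ) : ℂ) *
        (Complex.exp (-Complex.I * (inner ℝ ξ x : ℝ)) * φ ξ)) w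
    rw [← h1, ← integral_gaussian_mul_exp ht, ← integral_mul_const]
    refine integral_congr_ae (.of_forall fun x => ?_)
    simp only [add_sub_cancel_right, inner_add_right, Complex.ofReal_add, mul_add, Complex.exp_add]
    rw [real_inner_comm w ξ]
    ring
  · refine (integrable_phase_mul hg (φ.integrable (μ := volume))
      (p := fun q => inner ℝ q.2 q.1) (by fun_prop)).congr (.of_forall fun q => ?_)
    simp only [Function.uncurry]
    ring

/-- The constant in the Fourier transform of the Riesz kernel `|x|^{2s-d}`. -/
noncomputable def rieszFTConst (d : ℕ) (s : ℝ) : ℝ :=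
  Real.pi ^ ((d : ℝ) / 2) * Real.Gamma s * 4 ^ s / Real.Gamma (d / 2 - s)

/-- With the common weight `t^{d/2-s-1}`, Gaussians superpose to a multiple of `|x-w|^{2s-d}` and
their transforms to a multiple of `|ξ|^{-2s}` times a phase. The identity is that of
`integral_gaussian_mul_schwartzHat` integrated in `t`. -/
theorem integral_riesz_mul_schwartzHat [NeZero d] {s : ℝ} (hs : 0 < s) (hs' : s < (d : ℝ) / 2)
    (φ : 𝓢(Euc d, ℂ)) (w : Euc d) :
    ∫ x, ((‖x - w‖ ^ (-((d : ℝ) - 2 * s)) : ℝ) : ℂ) * schwartzHat d φ x =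
      (rieszFTConst d s : ℂ) * ∫ ξ, ((‖ξ‖ ^ (-(2 * s)) : ℝ) : ℂ) *
        (Complex.exp (-Complex.I * (inner ℝ w ξ : ℝ)) * φ ξ) := by
  have hb : 0 < (d : ℝ) / 2 - s := by linarith
  have hG := Real.Gamma_pos_of_pos hb
  obtain ⟨_, h0⟩ := exists_integrable_norm_rpow_mul_schwartz (b := (d : ℝ) - 2 * s) (by linarith)
    (by linarith) (schwartzHat d φ)
  have hi1 := (h0 w).1
  obtain ⟨_, h0'⟩ := exists_integrable_norm_rpow_mul_schwartz (b := 2 * s) (by linarith)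
    (by linarith) φ
  have hi2 := (h0' 0).1
  simp only [sub_zero] at hi2
  have hi2' : Integrable fun ξ : Euc d => ((‖ξ‖ ^ (-(2 * s)) : ℝ) : ℂ) *
        (Complex.exp (-Complex.I * (inner ℝ w ξ : ℝ)) * φ ξ) := by
    refine hi2.norm.mono' ((Measurable.aestronglyMeasurable (by fun_prop)).mul
      ((Measurable.aestronglyMeasurable (by fun_prop)).mul φ.continuous.aestronglyMeasurable))
      (.of_forall fun ξ => ?_)
    rw [norm_mul, norm_mul, norm_mul, norm_exp_neg_I_mul, one_mul]
  have hne : ∀ᵐ x : Euc d, 0 < ‖x - w‖ := by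
    filter_upwards [Measure.ae_ne volume w] with x hx
    exact norm_pos_iff.2 (sub_ne_zero.2 hx)
  have hne0 : ∀ᵐ x : Euc d, 0 < ‖x‖ := by
    filter_upwards [Measure.ae_ne volume (0 : Euc d)] with x hx
    exact norm_pos_iff.2 hx
  have e1 := integral_superposition (ν := (volume : Measure (Euc d)))
    (k := fun q => q.1 ^ ((d : ℝ) / 2 - s - 1) * Real.exp (-(q.1 * ‖q.2 - w‖ ^ 2)))
    (K := fun x => Real.Gamma (d / 2 - s) * ‖x - w‖ ^ (-((d : ℝ) - 2 * s)))
    (Φ := schwartzHat d φ) (by fun_prop) (fun t ht x => by positivity)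
    (schwartzHat d φ).continuous.aestronglyMeasurable (by
      filter_upwards [hne] with x hx
      have h := Real.integral_rpow_mul_exp_neg_mul_Ioi hb (pow_pos hx 2)
      have e : (1 / ‖x - w‖ ^ 2) ^ ((d : ℝ) / 2 - s) * Real.Gamma (d / 2 - s) =
          Real.Gamma (d / 2 - s) * ‖x - w‖ ^ (-((d : ℝ) - 2 * s)) := by
        rw [one_div, Real.inv_rpow (by positivity), ← Real.rpow_natCast, ← Real.rpow_mul hx.le,
          ← Real.rpow_neg hx.le, mul_comm]
        congr 2
        push_cast; ring
      rw [e] at h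
      simp only [mul_comm (‖x - w‖ ^ 2)] at h
      refine ⟨?_, h⟩
      by_contra hc
      rw [integral_undef hc] at h
      have : 0 < Real.Gamma (d / 2 - s) * ‖x - w‖ ^ (-((d : ℝ) - 2 * s)) := by positivity
      linarith) (by
      refine (hi1.const_mul (Real.Gamma (d / 2 - s) : ℂ)).congr (.of_forall fun x => ?_)
      push_cast; ring)
  have e2 := integral_superposition (ν := (volume : Measure (Euc d)))
    (k := fun q => q.1 ^ ((d : ℝ) / 2 - s - 1) * ((Real.pi / q.1) ^ ((d : ℝ) / 2) *
      Real.exp (-(‖q.2‖ ^ 2 / (4 * q.1)))))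
    (K := fun ξ => Real.pi ^ ((d : ℝ) / 2) * Real.Gamma s * 4 ^ s * ‖ξ‖ ^ (-(2 * s)))
    (Φ := fun ξ => Complex.exp (-Complex.I * (inner ℝ w ξ : ℝ)) * φ ξ)
    (by fun_prop) (fun t ht x => by positivity)
    ((Measurable.aestronglyMeasurable (by fun_prop)).mul φ.continuous.aestronglyMeasurable) (by
      filter_upwards [hne0] with ξ hξ
      exact integrableOn_and_integral_heat hs hξ) (by
      refine (hi2'.const_mul ((Real.pi ^ ((d : ℝ) / 2) * Real.Gamma s * 4 ^ s : ℝ) : ℂ)).congr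
        (.of_forall fun x => ?_)
      push_cast; ring)
  have e3 : ∫ t in Set.Ioi (0 : ℝ), ∫ x : Euc d, ((t ^ ((d : ℝ) / 2 - s - 1) *
      Real.exp (-(t * ‖x - w‖ ^ 2)) : ℝ) : ℂ) * schwartzHat d φ x =
      ∫ t in Set.Ioi (0 : ℝ), ∫ ξ : Euc d, ((t ^ ((d : ℝ) / 2 - s - 1) *
        ((Real.pi / t) ^ ((d : ℝ) / 2) * Real.exp (-(‖ξ‖ ^ 2 / (4 * t)))) : ℝ) : ℂ) *
        (Complex.exp (-Complex.I * (inner ℝ w ξ : ℝ)) * φ ξ) := by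
    refine setIntegral_congr_fun measurableSet_Ioi fun t ht => ?_
    have h := integral_gaussian_mul_schwartzHat φ w (t := t) ht
    simp only [Complex.ofReal_mul (t ^ ((d : ℝ) / 2 - s - 1)), mul_assoc (Complex.ofReal _)]
    rw [integral_const_mul, h, integral_const_mul]
  have e4 := (e1.trans e3).trans e2.symm
  simp only [Complex.ofReal_mul (Real.Gamma _),
    Complex.ofReal_mul (Real.pi ^ ((d : ℝ) / 2) * Real.Gamma s * 4 ^ s),
    mul_assoc (Complex.ofReal _)] at e4
  rw [integral_const_mul, integral_const_mul] at e4
  have hG' : (Real.Gamma (d / 2 - s) : ℂ) ≠ 0 := by exact_mod_cast hG.ne'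
  rw [rieszFTConst, Complex.ofReal_div, div_mul_eq_mul_div, eq_div_iff hG', mul_comm, e4]

theorem integrable_riesz_prod [NeZero d] {b : ℝ} (hb0 : 0 ≤ b) (hb : b < d) (ψ : 𝓢(Euc d, ℂ)) :
    Integrable (fun q : Euc d × Sph d => ((‖q.1 - (q.2 : Euc d)‖ ^ (-b) : ℝ) : ℂ) * ψ q.1)
      (volume.prod (surf d)) := by
  obtain ⟨C, hC⟩ := exists_integrable_norm_rpow_mul_schwartz hb0 hb ψ
  have hm : AEStronglyMeasurable
      (fun q : Euc d × Sph d => ((‖q.1 - (q.2 : Euc d)‖ ^ (-b) : ℝ) : ℂ) * ψ q.1)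
      (volume.prod (surf d)) :=
    (Measurable.aestronglyMeasurable (by fun_prop)).mul
      (ψ.continuous.comp continuous_fst).aestronglyMeasurable
  rw [integrable_prod_iff' hm]
  refine ⟨.of_forall fun ω => (hC ω).1, ?_⟩
  refine (integrable_const C).mono' hm.norm.prod_swap.integral_prod_right' (.of_forall fun ω => ?_)
  rw [Real.norm_of_nonneg (integral_nonneg fun x => norm_nonneg _)]
  exact (hC ω).2

theorem rieszConvSurf_mul (s : ℝ) (x : Euc d) (z : ℂ) : rieszConvSurf d s x * z =
    ∫ ω : Sph d, ((‖x - (ω : Euc d)‖ ^ (-((d : ℝ) - 2 * s)) : ℝ) : ℂ) * z ∂(surf d) := by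
  rw [integral_mul_const, rieszConvSurf, ← integral_complex_ofReal]
  congr 2
  ext ω
  rw [Real.rpow_neg (norm_nonneg _), one_div]

theorem integrable_rieszConvSurf_mul [NeZero d] {s : ℝ} (hs : 0 < s) (hs' : s < (d : ℝ) / 2)
    (ψ : 𝓢(Euc d, ℂ)) : Integrable fun x => rieszConvSurf d s x * ψ x := by
  simp_rw [rieszConvSurf_mul]
  exact (integrable_riesz_prod (by linarith) (by linarith) ψ).integral_prod_left

theorem extFun_one_eq [NeZero d] (s : ℝ) {ξ : Euc d} (hξ : ξ ≠ 0) :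
    extFun s (fun _ => 1) ξ = (((2 * Real.pi) ^ ((d : ℝ) / 2) : ℝ) : ℂ) * besselProfile d s ξ := by
  have hr : 0 < ‖ξ‖ := norm_pos_iff.2 hξ
  have h1 : sphFT (fun _ => 1) ξ = surfHat d ξ := by simp [sphFT, surfHat]
  have h2 : ‖ξ‖ ^ (-(2 * s)) * ‖ξ‖ ^ (1 - (d : ℝ) / 2) = (‖ξ‖ ^ ((d : ℝ) / 2 + 2 * s - 1))⁻¹ := by
    rw [← Real.rpow_add hr, ← Real.rpow_neg hr.le]
    congr 1
    ring
  rw [extFun, h1, surfHat_eq_besselJ hξ, besselProfile, ← Complex.ofReal_mul, ← Complex.ofReal_mul,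
    Complex.ofReal_inj, div_eq_mul_inv (besselJ _ _), ← h2]
  ring

theorem extFun_one_ae_eq [NeZero d] (s : ℝ) : extFun s (fun _ : Sph d => 1) =ᵐ[volume]
    (((2 * Real.pi) ^ ((d : ℝ) / 2) : ℝ) : ℂ) • besselProfile d s := by
  filter_upwards [Measure.ae_ne volume (0 : Euc d)] with ξ hξ
  exact extFun_one_eq s hξ

/-- Up to a constant the profile is `|ξ|^{-2s} (dσ)^`, and `(dσ)^` is bounded by the mass of the
sphere; `2s < d` gives integrability at the origin. -/
theorem integrable_besselProfile_mul [NeZero d] {s : ℝ} (hs : 0 < s) (hs' : s < (d : ℝ) / 2)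
    (ψ : 𝓢(Euc d, ℂ)) : Integrable fun ξ => besselProfile d s ξ * ψ ξ := by
  obtain ⟨_, h0⟩ := exists_integrable_norm_rpow_mul_schwartz (b := 2 * s) (by linarith)
    (by linarith) ψ
  have h1 := (h0 0).1
  simp only [sub_zero] at h1
  have hc := continuous_sphFT (integrable_const (1 : ℂ) : Integrable (fun _ : Sph d => (1 : ℂ)) _)
  have h2 : Integrable fun ξ => extFun s (fun _ : Sph d => 1) ξ * ψ ξ := by
    refine (h1.norm.const_mul (∫ _ : Sph d, ‖(1 : ℂ)‖ ∂(surf d))).mono'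
      (((Measurable.aestronglyMeasurable (by fun_prop)).mul hc.aestronglyMeasurable).mul
        ψ.continuous.aestronglyMeasurable) (.of_forall fun ξ => ?_)
    rw [extFun, norm_mul, norm_mul, norm_mul, mul_comm (‖((‖ξ‖ ^ (-(2 * s)) : ℝ) : ℂ)‖), mul_assoc]
    gcongr
    exact norm_sphFT_le _ ξ
  have hp : (((2 * Real.pi) ^ ((d : ℝ) / 2) : ℝ) : ℂ) ≠ 0 := by
    exact_mod_cast (by positivity : 0 < (2 * Real.pi) ^ ((d : ℝ) / 2)).ne'
  refine (h2.const_mul ((((2 * Real.pi) ^ ((d : ℝ) / 2) : ℝ) : ℂ)⁻¹)).congr ?_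
  filter_upwards [extFun_one_ae_eq (d := d) s] with ξ hξ
  rw [hξ, Pi.smul_apply, smul_eq_mul]
  field_simp

/-- The constant relating `|·|^{2s-d} * dσ` and its Fourier transform. -/
noncomputable def convConst (d : ℕ) (s : ℝ) : ℂ :=
  ((rieszFTConst d s * (2 * Real.pi) ^ ((d : ℝ) / 2) : ℝ) : ℂ)

theorem convConst_ne_zero {s : ℝ} (hs : 0 < s) (hs' : s < (d : ℝ) / 2) : convConst d s ≠ 0 := by
  have h1 := Real.Gamma_pos_of_pos hs
  have h2 := Real.Gamma_pos_of_pos (show 0 < (d : ℝ) / 2 - s by linarith)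
  have : 0 < rieszFTConst d s * (2 * Real.pi) ^ ((d : ℝ) / 2) := by
    unfold rieszFTConst
    positivity
  exact Complex.ofReal_ne_zero.2 this.ne'

theorem integral_rieszConvSurf_mul_schwartzHat [NeZero d] {s : ℝ} (hs : 0 < s)
    (hs' : s < (d : ℝ) / 2) (φ : 𝓢(Euc d, ℂ)) :
    ∫ x, rieszConvSurf d s x * schwartzHat d φ x =
      convConst d s * ∫ ξ, besselProfile d s ξ * φ ξ := by
  simp_rw [rieszConvSurf_mul]
  rw [integral_integral_swap (integrable_riesz_prod (by linarith) (by linarith) _)]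
  simp_rw [integral_riesz_mul_schwartzHat hs hs']
  rw [integral_const_mul, integral_integral_swap]
  · rw [convConst, Complex.ofReal_mul, mul_assoc,
      ← integral_const_mul (((2 * Real.pi) ^ ((d : ℝ) / 2) : ℝ) : ℂ)]
    congr 1
    refine integral_congr_ae ?_
    filter_upwards [extFun_one_ae_eq (d := d) s] with ξ hξ
    rw [Pi.smul_apply, smul_eq_mul] at hξ
    rw [← mul_assoc, ← hξ, extFun, sphFT, mul_assoc, ← integral_mul_const, ← integral_const_mul]
    simp
  · obtain ⟨_, h0⟩ := exists_integrable_norm_rpow_mul_schwartz (b := 2 * s) (by linarith)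
      (by linarith) φ
    have h1 := (h0 0).1
    simp only [sub_zero] at h1
    refine (integrable_phase_mul (integrable_const (1 : ℂ) : Integrable (fun _ : Sph d => (1 : ℂ)) _)
      h1 (p := fun q => inner ℝ (q.1 : Euc d) q.2) (by fun_prop)).congr (.of_forall fun q => ?_)
    simp only [Function.uncurry]
    ring

/-- Every Schwartz function is a `schwartzHat`, so testing `f` against transforms loses nothing and
the pairing identity works in both directions. -/
theorem represents_rieszConvSurf_iff [NeZero d] {s : ℝ} (hs : 0 < s) (hs' : s < (d : ℝ) / 2)
    (c : ℂ) (f : 𝓢'(Euc d, ℂ)) : Represents (c • rieszConvSurf d s) f ↔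
      Represents ((c * convConst d s) • besselProfile d s) (hat f) := by
  have h1 : ∀ φ : 𝓢(Euc d, ℂ), Integrable fun x => (c • rieszConvSurf d s) x * φ x := fun φ => by
    simp only [Pi.smul_apply, smul_eq_mul, mul_assoc]
    exact (integrable_rieszConvSurf_mul hs hs' φ).const_mul c
  have h2 : ∀ φ : 𝓢(Euc d, ℂ),
      Integrable fun x => ((c * convConst d s) • besselProfile d s) x * φ x := fun φ => by
    simp only [Pi.smul_apply, smul_eq_mul, mul_assoc]
    exact ((integrable_besselProfile_mul hs hs' φ).const_mul _).const_mul c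
  have h3 : ∀ φ : 𝓢(Euc d, ℂ), ∫ x, (c • rieszConvSurf d s) x * schwartzHat d φ x =
      ∫ ξ, ((c * convConst d s) • besselProfile d s) ξ * φ ξ := fun φ => by
    simp only [Pi.smul_apply, smul_eq_mul, mul_assoc]
    rw [integral_const_mul, integral_rieszConvSurf_mul_schwartzHat hs hs', integral_const_mul,
      integral_const_mul]
  constructor
  · intro h φ
    exact ⟨h2 φ, by rw [hat_apply, (h _).2, h3]⟩
  · intro h φ
    refine ⟨h1 φ, ?_⟩
    obtain ⟨ψ, rfl⟩ := schwartzHat_surjective φ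
    rw [← hat_apply, (h ψ).2, h3]

/-! ### Characterisation of the extremisers. -/

theorem isExtremiser_iff_hat (hd : 2 ≤ d) {s : ℝ} (hs : 1 / 2 < s) (hs' : s < (d : ℝ) / 2)
    (f : 𝓢'(Euc d, ℂ)) : IsExtremiser s f ↔
      (∃ c : ℂ, Represents (c • besselProfile d s) (hat f)) ∧ hat f ≠ 0 := by
  have : NeZero d := ⟨by omega⟩
  have hC := traceConst_pos hs hs'
  have hE : ∀ g, ‖extCLM hd hs hs' g‖ ^ 2 ≤ traceConst d s * ‖g‖ ^ 2 := norm_extOp_sq_le hd hs hs'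
  have hp : (((2 * Real.pi) ^ ((d : ℝ) / 2) : ℝ) : ℂ) ≠ 0 := by
    exact_mod_cast (by positivity : 0 < (2 * Real.pi) ^ ((d : ℝ) / 2)).ne'
  rw [hat_ne_zero_iff]
  constructor
  · rintro ⟨hf, hne, G, hG, hnorm⟩
    refine ⟨?_, hne⟩
    obtain ⟨h, hh, hm⟩ := memSobolevHom_iff.1 hf
    rw [isTrace_iff hd hs hs' hh hm] at hG
    have hn : sobolevNorm s f = ‖hm.toLp h‖ := by
      rw [sobolevNorm, sobolevENorm_eq_eLpNorm hh, Lp.norm_toLp]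
    rw [hG, hn] at hnorm
    -- With `G` the trace: `E G = C h`, and `G` is extremal for `E`, hence constant. So `h = C⁻¹ E
    -- G` is a multiple of `E 1`.
    obtain ⟨h1, h2⟩ := apply_adjoint_eq_of_norm_sq_eq hC hE hnorm
    rw [← hG] at h1 h2
    obtain ⟨c, hc⟩ := (norm_extOp_sq_eq_iff hd hs hs' G).1 h2
    refine ⟨(traceConst d s : ℂ)⁻¹ * (c * (((2 * Real.pi) ^ ((d : ℝ) / 2) : ℝ) : ℂ)),
      hh.congr ?_⟩
    have h3 := extCLM_coeFn hd hs hs' G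
    rw [h1, extFun_congr s hc] at h3
    have h4 : extFun s (fun _ : Sph d => c) = c • extFun s (fun _ : Sph d => 1) := by
      rw [← extFun_smul]
      congr 1
      ext
      simp
    rw [h4] at h3
    have h5 : h =ᵐ[sobMeasure d s] (traceConst d s : ℂ)⁻¹ • c • extFun s (fun _ : Sph d => 1) := by
      filter_upwards [h3, hm.coeFn_toLp, Lp.coeFn_smul (traceConst d s : ℂ) (hm.toLp h)]
        with ξ e1 e2 e3
      have hC' : (traceConst d s : ℂ) ≠ 0 := by exact_mod_cast hC.ne'
      rw [e3, Pi.smul_apply, e2] at e1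
      rw [Pi.smul_apply, ← e1, smul_smul, inv_mul_cancel₀ hC', one_smul]
    filter_upwards [(absolutelyContinuous_sobMeasure s).ae_eq h5, extFun_one_ae_eq (d := d) s]
      with ξ e1 e2
    rw [e1, Pi.smul_apply, Pi.smul_apply, e2]
    simp only [Pi.smul_apply, smul_eq_mul]
    ring
  · rintro ⟨⟨c, hc⟩, hne⟩
    -- Normalised so that `E` maps the constant `c'` to `c` times the Bessel profile; the
    -- extremality of constants for `E` then transfers to its adjoint.
    set c' : ℂ := c / (((2 * Real.pi) ^ ((d : ℝ) / 2) : ℝ) : ℂ) with hc'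
    set u : Lp ℂ 2 (surf d) := (memLp_const c').toLp fun _ => c' with hu
    have huc : u =ᵐ[surf d] fun _ => c' := (memLp_const c').coeFn_toLp
    have h4 : extFun s u = c' • extFun s (fun _ : Sph d => 1) := by
      rw [extFun_congr s huc, ← extFun_smul]
      congr 1
      ext
      simp
    have h5 : extCLM hd hs hs' u =ᵐ[sobMeasure d s] c • besselProfile d s := by
      filter_upwards [extCLM_coeFn hd hs hs' u,
        (sobMeasure_absolutelyContinuous s).ae_eq (extFun_one_ae_eq (d := d) s)] with ξ e1 e2
      rw [e1, h4, Pi.smul_apply, e2, hc']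
      simp only [Pi.smul_apply, smul_eq_mul]
      field_simp
    have hm : MemLp (c • besselProfile d s) 2 (sobMeasure d s) :=
      (memLp_congr_ae h5).1 (Lp.memLp _)
    have h6 : hm.toLp _ = extCLM hd hs hs' u := by
      rw [← Lp.toLp_coeFn (extCLM hd hs hs' u) (Lp.memLp _)]
      exact MemLp.toLp_congr _ _ h5.symm
    refine ⟨memSobolevHom_iff.2 ⟨_, hc, hm⟩, hne, _, (isTrace_iff hd hs hs' hc hm _).2 rfl, ?_⟩
    rw [sobolevNorm, sobolevENorm_eq_eLpNorm hc, ← Lp.norm_toLp _ hm, h6]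
    exact norm_adjoint_apply_sq_eq hC hE ((norm_extOp_sq_eq_iff hd hs hs' u).2 ⟨c', huc⟩)

end SphereTrace

theorem theorem1 (d : ℕ) (hd : 2 ≤ d) (s : ℝ) (hs : 1 / 2 < s) (hs' : s < (d : ℝ) / 2) :
    (∀ f : 𝓢'(SphereTrace.Euc d, ℂ), SphereTrace.MemSobolevHom s f →
      (∃! G : Lp ℂ 2 (SphereTrace.surf d), SphereTrace.IsTrace s f G) ∧
      ∀ G : Lp ℂ 2 (SphereTrace.surf d), SphereTrace.IsTrace s f G →
        ‖G‖ ^ 2 ≤ SphereTrace.traceConst d s * SphereTrace.sobolevNorm s f ^ 2) ∧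
    (∀ f : 𝓢'(SphereTrace.Euc d, ℂ),
      (SphereTrace.IsExtremiser s f ↔
        (∃ c : ℂ, SphereTrace.Represents (c • SphereTrace.rieszConvSurf d s) f) ∧ f ≠ 0) ∧
      (SphereTrace.IsExtremiser s f ↔
        (∃ c : ℂ, SphereTrace.Represents (c • SphereTrace.besselProfile d s)
          (SphereTrace.hat f)) ∧ SphereTrace.hat f ≠ 0)) := by
  have : NeZero d := ⟨by omega⟩
  have hs0 : 0 < s := by linarith
  refine ⟨fun f hf => ?_, fun f => ⟨?_, SphereTrace.isExtremiser_iff_hat hd hs hs' f⟩⟩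
  · obtain ⟨h, hh, hm⟩ := SphereTrace.memSobolevHom_iff.1 hf
    refine ⟨⟨_, (SphereTrace.isTrace_iff hd hs hs' hh hm _).2 rfl,
      fun G hG => (SphereTrace.isTrace_iff hd hs hs' hh hm G).1 hG⟩, fun G hG => ?_⟩
    rw [(SphereTrace.isTrace_iff hd hs hs' hh hm G).1 hG, SphereTrace.sobolevNorm,
      SphereTrace.sobolevENorm_eq_eLpNorm hh, ← Lp.norm_toLp _ hm]
    exact SphereTrace.norm_adjoint_apply_sq_le (SphereTrace.traceConst_pos hs hs').le
      (SphereTrace.norm_extOp_sq_le hd hs hs') _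
  · rw [SphereTrace.isExtremiser_iff_hat hd hs hs', SphereTrace.hat_ne_zero_iff]
    refine and_congr_left' ⟨?_, ?_⟩
    · rintro ⟨c, hc⟩
      refine ⟨c / SphereTrace.convConst d s,
        (SphereTrace.represents_rieszConvSurf_iff hs0 hs' _ f).2 ?_⟩
      rwa [div_mul_cancel₀ _ (SphereTrace.convConst_ne_zero hs0 hs')]
    · rintro ⟨c, hc⟩
      exact ⟨_, (SphereTrace.represents_rieszConvSurf_iff hs0 hs' c f).1 hc⟩
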